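/- Let $d\ge 1$ and let $D:\mathbb Z^d\to[-\infty,\infty)$ be a displacement function: $D(\mathbf 0)=1$, and $\mathcal N=\{x: D(x)\ne-\infty\}$ is finite with at least two elements. Particles arrive at the sites of $\mathbb Z^d$ at the times of independent homogeneous Poisson processes of unit rate on $(0,\infty)$. For a height profile $\xi:\mathbb Z^d\to[-\infty,\infty)$ define the next-arrival profile $\eta(x)=\max_{y\in\mathbb Z^d}\{\xi(y)+D(x-y)\}$. The ballistic deposition (BD) process with displacement function $D$ started from a profile $\xi_0$ is the process $(\xi_t(z))_{t\ge0,\,z\in\mathbb Z^d}$ that equals $\xi_0$ at time $0$, such that $\xi_t(z)$ changes only at arrival times at $z$ (it is constant on $[s,t]$ if there is no arrival at $z$ in $(s,t]$), and at each arrival time $t$ at $z$ is updated to $\xi_t(z)=\eta_{t-}(z)=\lim_{s\uparrow t}\eta_s(z)$, where $\eta_s$ is the next-arrival profile of $\xi_s$. Let $(\xi_t)$ be the BD process with displacement function $D$ and $\xi_0\equiv0$, with next-arrival process $(\eta_t)$. Let $(\hat\xi_t)$, with next-arrival process $(\hat\eta_t)$, be the dual BD process: it is defined in the same way, from the displacement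 function $\hat D(x)=D(-x)$ and the initial profile $\hat\xi_0(\mathbf 0)=0$, $\hat\xi_0(x)=-\infty$ for $x\neq\mathbf 0$. Let $T$ be exponentially distributed with mean $1$ and independent of the process $(\hat\eta_s(x))_{s\ge0,\,x\in\mathbb Z^d}$, and let the delayed dual BD process be $$\tilde\eta_t(x)=\begin{cases}\hat\eta_{t-T}(x), & t\ge T,\\ 0, & t<T.\end{cases}$$ **Theorem.** Almost surely, the processes $\xi$ and $\hat\xi$ exist and are uniquely determined by the arrival times. For every $t>0$, $\eta_t(\mathbf 0)$ has the same distribution as $\sup_{z\in\mathbb Z^d}\hat\eta_t(z)$, and $\xi_t(\mathbf 0)$ has the same distribution as $\sup_{z\in\mathbb Z^d}\tilde\eta_t(z)$. -/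

import Mathlib

open MeasureTheory ProbabilityTheory Filter Topology
open scoped NNReal

/-- The integer lattice `ℤ^d`. -/
abbrev Site (d : ℕ) : Type := Fin d → ℤ

/-- A displacement function `D : ℤ^d → [-∞, ∞)`: `D(0) = 1`, and the neighbourhood
`{x | D x ≠ -∞}` of the origin is finite and has at least two elements. -/
structure IsDisplacement {d : ℕ} (D : Site d → EReal) : Prop where
  ne_top : ∀ x, D x ≠ ⊤
  zero : D 0 = 1
  finite : {x | D x ≠ ⊥}.Finite
  two_le : 2 ≤ {x | D x ≠ ⊥}.ncard

/-- The next-arrival height at `x` for the last-arrival profile `ξ`: the maximum over `y` of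
`ξ y + D (x - y)`. In `EReal` one has `⊥ + a = a + ⊥ = ⊥`. -/
noncomputable def nextArrival {d : ℕ} (D : Site d → EReal) (ξ : Site d → EReal) (x : Site d) :
    EReal :=
  ⨆ y, ξ y + D (x - y)

/-- `ξ t z` is the last-arrival height at time `t` above site `z` of the ballistic deposition
process with displacement function `D` and initial profile `ξ₀`, when the particles arrive at
site `z` at the times in `arr z`. -/
structure IsBallisticDeposition {d : ℕ} (D : Site d → EReal) (arr : Site d → Set ℝ≥0)
    (ξ₀ : Site d → EReal) (ξ : ℝ≥0 → Site d → EReal) : Prop where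
  /-- The initial condition. -/
  init : ξ 0 = ξ₀
  /-- The height above `z` does not change on a time interval `(s, t]` without arrival at `z`. -/
  const : ∀ z s t, s ≤ t → (∀ u ∈ Set.Ioc s t, u ∉ arr z) → ξ t z = ξ s z
  /-- At an arrival the height is updated to the next-arrival height immediately before. -/
  update : ∀ z, ∀ t ∈ arr z, 0 < t →
    Tendsto (fun s => nextArrival D (ξ s) z) (𝓝[<] t) (𝓝 (ξ t z))

/-- The flat initial profile. -/
noncomputable def flatProfile (d : ℕ) : Site d → EReal := fun _ => 0

open Classical in
/-- The initial profile with a single particle, at height `0` at the origin. -/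
noncomputable def seedProfile (d : ℕ) : Site d → EReal := fun x => if x = 0 then 0 else ⊥

/-- The dual (reflected) displacement function. -/
def dualDisplacement {d : ℕ} (D : Site d → EReal) : Site d → EReal := fun x => D (-x)

/-- The number of arrivals in the time interval `(0, t]`. -/
noncomputable def arrivalCount (a : Set ℝ≥0) (t : ℝ≥0) : ℕ := (a ∩ Set.Ioc 0 t).ncard

/-- `A z ω` is the set of arrival times at site `z`; these sets are independent homogeneous
Poisson processes of unit rate on `(0, ∞)`, one for each site. -/
structure IsPoissonArrivals {d : ℕ} {Ω : Type*} [MeasurableSpace Ω] (μ : Measure Ω)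
    (A : Site d → Ω → Set ℝ≥0) : Prop where
  /-- Almost surely there is no arrival at time `0`. -/
  zero_notMem : ∀ᵐ ω ∂μ, ∀ z, (0 : ℝ≥0) ∉ A z ω
  /-- Almost surely there are only finitely many arrivals at each site in bounded time. -/
  locallyFinite : ∀ᵐ ω ∂μ, ∀ z t, (A z ω ∩ Set.Iic t).Finite
  /-- The number of arrivals at a site in `(s, t]` is Poisson with mean `t - s`. -/
  law : ∀ z s t, s ≤ t →
    HasLaw (fun ω => arrivalCount (A z ω) t - arrivalCount (A z ω) s) (poissonMeasure (t - s)) μ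
  /-- The counting process at each site has independent increments. -/
  indep_increments : ∀ z, HasIndepIncrements (fun t ω => arrivalCount (A z ω) t) μ
  /-- The counting processes at different sites are independent. -/
  indep_sites : iIndepFun (fun z ω t => arrivalCount (A z ω) t) μ

/-- The delayed process: nothing is there (height `0`) before the kick-off time `T`, and from time
`T` on it follows the next-arrival process of `ξ`, started at time `T`. -/
noncomputable def delayedNextArrival {d : ℕ} (D : Site d → EReal) (ξ : ℝ≥0 → Site d → EReal)
    (T : ℝ≥0) (t : ℝ≥0) (x : Site d) : EReal :=
  if T ≤ t then nextArrival D (ξ (t - T)) x else 0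

/-!
**Well-posedness.** The height above `z` before time `t` depends on earlier space-time points through
the relation `Precedes`. If that relation is well-founded and the arrivals are locally finite
(`IsHarris`), then existence is a recursion and uniqueness an induction along it. Almost sure
well-foundedness is Harris' percolation argument (`IsPoissonArrivals.ae_isHarris`): in time windows
of short length the sites with an arrival do not percolate, since the expected number of open
self-avoiding paths of length `n` decays geometrically; the times along an infinite chain of arrivals
would decrease to a limit and so would end up in a single window.

**Duality.** In discrete time, where in each step a set of sites is updated simultaneously, the
pairing `⨆ x y, f y + D (x - y) + g x` turns an update of `f` into the same update of `g` for the
reflected displacement function. Here `D 0 = 1 ≥ 0` is used: an update only raises heights, so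
the pairing becomes the supremum of its old value and a term symmetric in `f` and `g`. Iterating, the next-arrival height
at the origin from the flat profile on a set `B` equals, for the reversed order of updates, the
supremum over `B` of the dual next-arrival heights (`IsDisplacement.discrete_duality`). The numbers
of arrivals in the intervals of a uniform grid are independent and identically distributed, so
reversal does not change their law. As the mesh tends to zero the discretized processes are almost
surely eventually equal to the true ones (`IsHarris.eventually_discreteBD_eq`), again by induction
along `Precedes`. This gives duality in law for a finite box `B`; as `B` grows to the whole lattice,
the left side is eventually constant because of well-foundedness and the right side converges
monotonically.

**The last-arrival height.** In discrete time the height at the origin is the next-arrival height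
just before the last update, and the number of steps since that update is geometric and independent
of that height (`integral_discreteBD`). Rounding the exponential delay down to the grid gives the same
geometric law (`integral_gridDelay`). Hence the two laws are the same mixtures of laws that
agree by the first duality, up to an error that vanishes with the mesh
(`identDistrib_height_box`).
-/

/-! ### Max-plus linear algebra over `EReal` -/

/-- Addition distributes over suprema on all of `EReal`, thanks to `⊥ + ⊤ = ⊥`. -/
theorem EReal.iSup_add_right {ι : Sort*} (f : ι → EReal) (c : EReal) :
    (⨆ i, f i) + c = ⨆ i, f i + c := by
  refine le_antisymm ?_ (iSup_le fun i => add_le_add_left (le_iSup f i) c)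
  induction c using EReal.rec with
  | bot => simp
  | coe r =>
    rw [← EReal.le_sub_iff_add_le (by simp) (by simp)]
    refine iSup_le fun i => ?_
    rw [EReal.le_sub_iff_add_le (by simp) (by simp)]
    exact le_iSup (fun i => f i + (r : EReal)) i
  | top =>
    by_cases h : ∃ i, f i ≠ ⊥
    · obtain ⟨i, hi⟩ := h
      refine le_trans le_top (le_iSup_of_le i ?_)
      rw [EReal.add_top_of_ne_bot hi]
    · push Not at h
      simp [h]

theorem EReal.add_sup (a b c : EReal) : c + (a ⊔ b) = (c + a) ⊔ (c + b) :=
  (add_right_mono (a := c)).map_sup a b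

section Deterministic

variable {d : ℕ} {D : Site d → EReal} {arr : Site d → Set ℝ≥0} {ξ₀ : Site d → EReal}
  {ξ : ℝ≥0 → Site d → EReal}

theorem nextArrival_congr {f g : Site d → EReal} {x : Site d}
    (h : ∀ y, D (x - y) ≠ ⊥ → f y = g y) : nextArrival D f x = nextArrival D g x := by
  refine iSup_congr fun y => ?_
  by_cases hy : D (x - y) = ⊥
  · simp [hy]
  · rw [h y hy]

theorem IsDisplacement.dual (hD : IsDisplacement D) : IsDisplacement (dualDisplacement D) where
  ne_top x := hD.ne_top _
  zero := by simpa [dualDisplacement] using hD.zero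
  finite := hD.finite.preimage neg_injective.injOn
  two_le := by
    have : {x | dualDisplacement D x ≠ ⊥} = Neg.neg '' {x | D x ≠ ⊥} := by
      ext x; simp [dualDisplacement]
    rw [this, Set.ncard_image_of_injective _ neg_injective]
    exact hD.two_le

theorem IsDisplacement.finite_neighbours (hD : IsDisplacement D) (z : Site d) :
    {y | D (z - y) ≠ ⊥}.Finite :=
  hD.finite.preimage (sub_right_injective (b := z)).injOn

/-- Since `D 0 = 1` is nonnegative, an arrival never lowers the height. -/
theorem IsDisplacement.le_nextArrival (hD : IsDisplacement D) (f : Site d → EReal) (x : Site d) :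
    f x ≤ nextArrival D f x := by
  refine le_iSup_of_le x ?_
  rw [sub_self, hD.zero]
  exact le_add_of_nonneg_right zero_le_one

/-! ### Existence, uniqueness and stability for well-founded arrivals -/

/-- The dependence relation between space-time points: the height at `p.2` immediately before
time `p.1` may depend on the height at `q.2` immediately before time `q.1`, because at the earlier
time `q.1` there is an arrival at `p.2`, and `q.2` is a site seen from `p.2`. -/
def Precedes (D : Site d → EReal) (arr : Site d → Set ℝ≥0) (q p : ℝ≥0 × Site d) : Prop :=
  q.1 ∈ arr p.2 ∧ 0 < q.1 ∧ q.1 < p.1 ∧ D (p.2 - q.2) ≠ ⊥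

/-- Arrival times for which the process is determined: they are locally finite at each site, and
no infinite chain of arrivals influences a space-time point. -/
structure IsHarris (D : Site d → EReal) (arr : Site d → Set ℝ≥0) : Prop where
  locallyFinite : ∀ z t, (arr z ∩ Set.Iic t).Finite
  wellFounded : WellFounded (Precedes D arr)

theorem exists_isGreatest_arrival (hfin : ∀ z t, (arr z ∩ Set.Iic t).Finite) {z : Site d}
    {s u : ℝ≥0} (h : ∃ r ∈ Set.Ioc s u, r ∈ arr z) :
    ∃ r, IsGreatest (arr z ∩ Set.Ioc s u) r := by
  have hf : (arr z ∩ Set.Ioc s u).Finite :=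
    (hfin z u).subset (Set.inter_subset_inter_right _ fun x hx => hx.2)
  obtain ⟨r, hr, hr'⟩ := h
  obtain ⟨m, hm, hm'⟩ := Set.exists_max_image _ id hf ⟨r, hr', hr⟩
  exact ⟨m, hm, fun x hx => hm' x hx⟩

theorem exists_lt_no_arrival (hfin : ∀ z t, (arr z ∩ Set.Iic t).Finite) {Y : Set (Site d)}
    (hY : Y.Finite) {s : ℝ≥0} (hs : 0 < s) :
    ∃ r < s, ∀ y ∈ Y, ∀ u ∈ Set.Ioo r s, u ∉ arr y := by
  have hf : (insert 0 (⋃ y ∈ Y, arr y ∩ Set.Iio s)).Finite :=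
    (hY.biUnion fun y _ => (hfin y s).subset
      (Set.inter_subset_inter_right _ fun x (hx : x < s) => hx.le)).insert 0
  obtain ⟨m, hm, hm'⟩ := Set.exists_max_image _ id hf ⟨0, Set.mem_insert _ _⟩
  refine ⟨m, ?_, fun y hy u hu hua => ?_⟩
  · rcases hm with rfl | hm
    · exact hs
    · simp only [Set.mem_iUnion] at hm
      obtain ⟨y, _, hy⟩ := hm
      exact hy.2
  · exact absurd (hm' u (Or.inr (Set.mem_biUnion hy ⟨hua, hu.2⟩))) (not_le.2 hu.1)

theorem exists_gt_no_arrival (hfin : ∀ z t, (arr z ∩ Set.Iic t).Finite) {Y : Set (Site d)}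
    (hY : Y.Finite) (s : ℝ≥0) :
    ∃ r > s, ∀ y ∈ Y, ∀ u ∈ Set.Ioc s r, u ∉ arr y := by
  have hf : (insert (s + 1) (⋃ y ∈ Y, arr y ∩ Set.Ioc s (s + 1))).Finite :=
    (hY.biUnion fun y _ => (hfin y (s + 1)).subset
      (Set.inter_subset_inter_right _ fun x hx => hx.2)).insert _
  obtain ⟨m, hm, hm'⟩ := Set.exists_min_image _ id hf ⟨_, Set.mem_insert _ _⟩
  have hsm : s < m := by
    rcases hm with rfl | hm
    · exact lt_add_one s
    · simp only [Set.mem_iUnion] at hm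
      obtain ⟨y, _, hy⟩ := hm
      exact hy.2.1
  have hm1 : m ≤ s + 1 := hm' (s + 1) (Set.mem_insert _ _)
  obtain ⟨r, hr, hrm⟩ := exists_between hsm
  refine ⟨r, hr, fun y hy u hu hua => ?_⟩
  have := hm' u (Or.inr (Set.mem_biUnion hy ⟨hua, hu.1, hu.2.trans (hrm.le.trans hm1)⟩))
  exact absurd this (not_le.2 (hu.2.trans_lt hrm))

/-- The limit in the update rule is attained: it is the next-arrival height at any earlier time
since which nothing happened at the sites seen from `z`. -/
theorem IsBallisticDeposition.eq_nextArrival (h : IsBallisticDeposition D arr ξ₀ ξ)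
    {z : Site d} {s t : ℝ≥0} (ht : t ∈ arr z) (hst : s < t)
    (hs : ∀ y, D (z - y) ≠ ⊥ → ∀ u ∈ Set.Ioo s t, u ∉ arr y) :
    ξ t z = nextArrival D (ξ s) z := by
  have ht0 : 0 < t := hst.pos
  have : (𝓝[<] t).NeBot := nhdsLT_neBot_of_exists_lt ⟨0, ht0⟩
  refine tendsto_nhds_unique (h.update z t ht ht0) (tendsto_const_nhds.congr' ?_)
  filter_upwards [Ioo_mem_nhdsLT hst] with r hr
  refine nextArrival_congr fun y hy => (h.const y s r hr.1.le fun u hu => ?_).symm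
  exact hs y hy u ⟨hu.1, hu.2.trans_lt hr.2⟩

theorem IsBallisticDeposition.eq_init (h : IsBallisticDeposition D arr ξ₀ ξ)
    {z : Site d} {t : ℝ≥0} (hs : ∀ u ∈ Set.Ioc 0 t, u ∉ arr z) : ξ t z = ξ₀ z := by
  rw [h.const z 0 t zero_le hs, h.init]

/-- Stability: processes driven by the same arrivals, whose initial profiles are eventually equal
at each site, are eventually equal at each site up to any given time. -/
theorem IsHarris.eventually_eq (hH : IsHarris D arr) (hD : IsDisplacement D) {ι : Type*}
    {l : Filter ι} {ζ₀ : ι → Site d → EReal} {ζ : ι → ℝ≥0 → Site d → EReal}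
    (h : IsBallisticDeposition D arr ξ₀ ξ) (h' : ∀ i, IsBallisticDeposition D arr (ζ₀ i) (ζ i))
    (h₀ : ∀ z, ∀ᶠ i in l, ζ₀ i z = ξ₀ z) (t : ℝ≥0) (z : Site d) :
    ∀ᶠ i in l, ∀ u < t, ζ i u z = ξ u z := by
  suffices H : ∀ p : ℝ≥0 × Site d, ∀ᶠ i in l, ∀ u < p.1, ζ i u p.2 = ξ u p.2 from H (t, z)
  clear t z
  intro p
  induction p using hH.wellFounded.induction with
  | _ p IH =>
  obtain ⟨t, z⟩ := p
  have hf : (arr z ∩ Set.Ioo 0 t).Finite := (hH.locallyFinite z t).subset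
    (Set.inter_subset_inter_right _ fun x hx => hx.2.le)
  have hall : ∀ᶠ i in l, ∀ s ∈ arr z ∩ Set.Ioo 0 t, ∀ y ∈ {y | D (z - y) ≠ ⊥}, ∀ u < s,
      ζ i u y = ξ u y := by
    rw [eventually_all_finite hf]
    intro s hs
    rw [eventually_all_finite (hD.finite_neighbours z)]
    intro y hy
    exact IH (s, y) ⟨hs.1, hs.2.1, hs.2.2, hy⟩
  filter_upwards [hall, h₀ z] with i hi hi₀ u hu
  by_cases hex : ∃ r ∈ Set.Ioc 0 u, r ∈ arr z
  · obtain ⟨s, hs, hs'⟩ := exists_isGreatest_arrival hH.locallyFinite hex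
    have hno : ∀ r ∈ Set.Ioc s u, r ∉ arr z := fun r hr hra =>
      absurd (hs' ⟨hra, hs.2.1.trans hr.1, hr.2⟩) (not_le.2 hr.1)
    obtain ⟨r, hr, hr'⟩ := exists_lt_no_arrival hH.locallyFinite (hD.finite_neighbours z) hs.2.1
    rw [h.const z s u hs.2.2 hno, (h' i).const z s u hs.2.2 hno,
      h.eq_nextArrival hs.1 hr hr', (h' i).eq_nextArrival hs.1 hr hr']
    exact nextArrival_congr fun y hy => hi s ⟨hs.1, hs.2.1, hs.2.2.trans_lt hu⟩ y hy r hr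
  · push Not at hex
    rw [h.eq_init hex, (h' i).eq_init hex, hi₀]

/-- Existence: the height immediately before a given time is defined by recursion along the
dependence relation. -/
theorem IsHarris.exists_isBallisticDeposition (hH : IsHarris D arr) (hD : IsDisplacement D)
    (ξ₀ : Site d → EReal) : ∃ ξ, IsBallisticDeposition D arr ξ₀ ξ := by
  classical
  -- `L (t, z)` is the height above `z` immediately before time `t`.
  obtain ⟨L, hL⟩ : ∃ L : ℝ≥0 × Site d → EReal, ∀ t z, L (t, z) =
      if h : ∃ s, IsGreatest (arr z ∩ Set.Ioo 0 t) s then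
        ⨆ y, L (h.choose, y) + D (z - y) else ξ₀ z := by
    refine ⟨hH.wellFounded.fix fun p IH =>
      if h : ∃ s, IsGreatest (arr p.2 ∩ Set.Ioo 0 p.1) s then
        ⨆ y, if hy : D (p.2 - y) ≠ ⊥ then
          IH (h.choose, y) ⟨h.choose_spec.1.1, h.choose_spec.1.2.1, h.choose_spec.1.2.2, hy⟩ +
            D (p.2 - y) else ⊥
      else ξ₀ p.2, fun t z => ?_⟩
    rw [WellFounded.fix_eq]
    split_ifs with h
    · refine iSup_congr fun y => ?_
      by_cases hy : D (z - y) = ⊥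
      · simp [hy]
      · simp [hy]
    · rfl
  let ξ : ℝ≥0 → Site d → EReal := fun t z =>
    if h : ∃ s, IsGreatest (arr z ∩ Set.Ioc 0 t) s then
      ⨆ y, L (h.choose, y) + D (z - y) else ξ₀ z
  have hξL : ∀ z u t, u < t → (∀ r ∈ Set.Ioo u t, r ∉ arr z) → ξ u z = L (t, z) := by
    intro z u t hut hno
    have : arr z ∩ Set.Ioc 0 u = arr z ∩ Set.Ioo 0 t := by
      ext r
      refine ⟨fun hr => ⟨hr.1, hr.2.1, hr.2.2.trans_lt hut⟩, fun hr => ⟨hr.1, hr.2.1, ?_⟩⟩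
      by_contra hur
      exact hno r ⟨not_le.1 hur, hr.2.2⟩ hr.1
    rw [hL]
    simp only [ξ, this]
  refine ⟨ξ, ?_, ?_, ?_⟩
  · ext z
    simp only [ξ]
    rw [dif_neg]
    rintro ⟨s, hs, _⟩
    exact absurd hs.2.1 (not_lt.2 hs.2.2)
  · intro z s t hst hno
    have : arr z ∩ Set.Ioc 0 t = arr z ∩ Set.Ioc 0 s := by
      ext r
      refine ⟨fun hr => ⟨hr.1, hr.2.1, ?_⟩, fun hr => ⟨hr.1, hr.2.1, hr.2.2.trans hst⟩⟩
      by_contra hur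
      exact hno r ⟨not_le.1 hur, hr.2.2⟩ hr.1
    simp only [ξ, this]
  · intro z t ht ht0
    have hg : IsGreatest (arr z ∩ Set.Ioc 0 t) t := ⟨⟨ht, ht0, le_rfl⟩, fun r hr => hr.2.2⟩
    have hex : ∃ s, IsGreatest (arr z ∩ Set.Ioc 0 t) s := ⟨t, hg⟩
    have hξt : ξ t z = ⨆ y, L (t, y) + D (z - y) := by
      simp only [ξ]
      rw [dif_pos hex, hex.choose_spec.unique hg]
    obtain ⟨r, hr, hr'⟩ := exists_lt_no_arrival hH.locallyFinite (hD.finite_neighbours z) ht0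
    refine tendsto_const_nhds.congr' ?_
    filter_upwards [Ioo_mem_nhdsLT hr] with s hs
    rw [hξt]
    refine iSup_congr fun y => ?_
    by_cases hy : D (z - y) = ⊥
    · simp [hy]
    · rw [hξL y s t hs.2 fun u hu => hr' y hy u ⟨hs.1.trans hu.1, hu.2⟩]

theorem IsHarris.existsUnique (hH : IsHarris D arr) (hD : IsDisplacement D)
    (ξ₀ : Site d → EReal) : ∃! ξ, IsBallisticDeposition D arr ξ₀ ξ := by
  obtain ⟨ξ, hξ⟩ := hH.exists_isBallisticDeposition hD ξ₀
  refine ⟨ξ, hξ, fun ζ hζ => ?_⟩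
  ext t z
  have := hH.eventually_eq hD (l := pure ()) (ζ₀ := fun _ => ξ₀) (ζ := fun _ => ζ) hξ
    (fun _ => hζ) (fun z => by simp) (t + 1) z
  exact this t (lt_add_one t)

/-! ### Discretization of time -/

/-- One step of the process in discrete time: the sites `z` with `c z ≠ 0` are updated
simultaneously. -/
noncomputable def bdStep (D : Site d → EReal) (c : Site d → ℕ) (f : Site d → EReal) :
    Site d → EReal :=
  fun z => if c z = 0 then f z else nextArrival D f z

/-- The process in discrete time: in step `k` the sites `z` with `c k z ≠ 0` are updated. -/
noncomputable def discreteBD (D : Site d → EReal) (ξ₀ : Site d → EReal) (c : ℕ → Site d → ℕ) :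
    ℕ → Site d → EReal
  | 0 => ξ₀
  | k + 1 => bdStep D (c k) (discreteBD D ξ₀ c k)

/-- The numbers of arrivals in the intervals `(k * h, (k + 1) * h]`. -/
noncomputable def arrivalIncr (arr : Site d → Set ℝ≥0) (h : ℝ≥0) (k : ℕ) (z : Site d) : ℕ :=
  arrivalCount (arr z) ((k + 1 : ℕ) * h) - arrivalCount (arr z) (k * h)

theorem arrivalIncr_eq_zero_iff (hfin : ∀ z t, (arr z ∩ Set.Iic t).Finite) (h : ℝ≥0) (k : ℕ)
    (z : Site d) :
    arrivalIncr arr h k z = 0 ↔ ∀ u ∈ Set.Ioc (k * h) ((k + 1 : ℕ) * h), u ∉ arr z := by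
  have hle : k * h ≤ (k + 1 : ℕ) * h := by gcongr; simp
  have hsub : arr z ∩ Set.Ioc 0 (k * h) ⊆ arr z ∩ Set.Ioc 0 ((k + 1 : ℕ) * h) :=
    Set.inter_subset_inter_right _ (Set.Ioc_subset_Ioc_right hle)
  have hf : (arr z ∩ Set.Ioc 0 ((k + 1 : ℕ) * h)).Finite :=
    (hfin z _).subset (Set.inter_subset_inter_right _ fun x hx => hx.2)
  rw [arrivalIncr, arrivalCount, arrivalCount, ← Set.ncard_sdiff hsub (hf.subset hsub),
    Set.ncard_eq_zero (hf.subset Set.sdiff_subset), Set.eq_empty_iff_forall_notMem]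
  refine ⟨fun H u hu hua => H u ⟨⟨hua, hu.1.pos, hu.2⟩, fun h' => ?_⟩, fun H u hu => ?_⟩
  · exact absurd h'.2.2 (not_le.2 hu.1)
  · refine H u ⟨?_, hu.1.2.2⟩ hu.1.1
    by_contra hlt
    exact hu.2 ⟨hu.1.1, hu.1.2.1, not_lt.1 hlt⟩

/-- As the mesh tends to zero, the discretized process at a site eventually coincides with the
process at all grid times in a bounded time interval. -/
theorem IsHarris.eventually_discreteBD_eq (hH : IsHarris D arr) (hD : IsDisplacement D)
    (hξ : IsBallisticDeposition D arr ξ₀ ξ) {h : ℕ → ℝ≥0} (hh : Tendsto h atTop (𝓝 0))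
    (t : ℝ≥0) (z : Site d) :
    ∀ᶠ n in atTop, ∀ k : ℕ, k * h n < t →
      discreteBD D ξ₀ (arrivalIncr arr (h n)) k z = ξ (k * h n) z := by
  suffices H : ∀ p : ℝ≥0 × Site d, ∀ᶠ n in atTop, ∀ k : ℕ, k * h n < p.1 →
      discreteBD D ξ₀ (arrivalIncr arr (h n)) k p.2 = ξ (k * h n) p.2 from H (t, z)
  clear t z
  intro p
  induction p using hH.wellFounded.induction with
  | _ p IH =>
  obtain ⟨t, z⟩ := p
  have hf : (arr z ∩ Set.Ioo 0 t).Finite := (hH.locallyFinite z t).subset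
    (Set.inter_subset_inter_right _ fun x hx => hx.2.le)
  have hall : ∀ᶠ n in atTop, ∀ s ∈ arr z ∩ Set.Ioo 0 t, ∀ y ∈ {y | D (z - y) ≠ ⊥},
      ∀ k : ℕ, k * h n < s →
        discreteBD D ξ₀ (arrivalIncr arr (h n)) k y = ξ (k * h n) y := by
    rw [eventually_all_finite hf]
    intro s hs
    rw [eventually_all_finite (hD.finite_neighbours z)]
    intro y hy
    exact IH (s, y) ⟨hs.1, hs.2.1, hs.2.2, hy⟩
  -- For a small mesh, the sites seen from `z` do not change in the grid interval containing an
  -- arrival at `z`, before that arrival.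
  have hmesh : ∀ᶠ n in atTop, ∀ s ∈ arr z ∩ Set.Ioo 0 t, ∀ r, r < s → s ≤ r + h n →
      ∀ y, D (z - y) ≠ ⊥ → ∀ u ∈ Set.Ioo r s, u ∉ arr y := by
    rw [eventually_all_finite hf]
    intro s hs
    obtain ⟨r, hr, hr'⟩ := exists_lt_no_arrival hH.locallyFinite (hD.finite_neighbours z) hs.2.1
    filter_upwards [hh.eventually_lt_const (tsub_pos_of_lt hr)] with n hn q hq hsq y hy u hu
    refine hr' y hy u ⟨lt_of_le_of_lt ?_ hu.1, hu.2⟩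
    by_contra hqr
    have : q + h n < r + (s - r) := add_lt_add (not_le.1 hqr) hn
    rw [add_tsub_cancel_of_le hr.le] at this
    exact absurd hsq (not_le.2 this)
  filter_upwards [hall, hmesh] with n hn hn' k
  induction k with
  | zero => intro _; simp [discreteBD, hξ.init]
  | succ k ihk =>
    intro hk
    have hle : (k : ℝ≥0) * h n ≤ (k + 1 : ℕ) * h n := by gcongr; simp
    have hadd : ((k + 1 : ℕ) : ℝ≥0) * h n = k * h n + h n := by push_cast; ring
    simp only [discreteBD, bdStep]
    split_ifs with hc
    · rw [arrivalIncr_eq_zero_iff hH.locallyFinite] at hc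
      rw [hξ.const z _ _ hle hc]
      exact ihk (hle.trans_lt hk)
    · rw [arrivalIncr_eq_zero_iff hH.locallyFinite] at hc
      push Not at hc
      obtain ⟨s, hs, hs'⟩ := exists_isGreatest_arrival hH.locallyFinite hc
      have hs0 : s ∈ arr z ∩ Set.Ioo 0 t := ⟨hs.1, hs.2.1.pos, hs.2.2.trans_lt hk⟩
      rw [hξ.const z s _ hs.2.2 fun r hr hra =>
        absurd (hs' ⟨hra, hs.2.1.trans hr.1, hr.2⟩) (not_le.2 hr.1)]
      rw [hξ.eq_nextArrival hs.1 hs.2.1 (hn' s hs0 _ hs.2.1 (hadd ▸ hs.2.2))]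
      exact nextArrival_congr fun y hy => hn s hs0 y hy k hs.2.1

/-! ### Duality in discrete time -/

/-- The max-plus bilinear form behind the duality: it is symmetric under exchanging the two
profiles together with reflecting the displacement function. -/
noncomputable def bdPairing (D : Site d → EReal) (f g : Site d → EReal) : EReal :=
  ⨆ x, nextArrival D f x + g x

theorem bdPairing_comm (D : Site d → EReal) (f g : Site d → EReal) :
    bdPairing D f g = bdPairing (dualDisplacement D) g f := by
  simp only [bdPairing, nextArrival, EReal.iSup_add_right]
  rw [iSup_comm]
  refine iSup_congr fun y => iSup_congr fun x => ?_
  rw [dualDisplacement, neg_sub, add_right_comm, add_comm (f y), add_right_comm]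

theorem IsDisplacement.bdStep_eq_sup (hD : IsDisplacement D) (c : Site d → ℕ)
    (f : Site d → EReal) (z : Site d) :
    bdStep D c f z = f z ⊔ if c z = 0 then ⊥ else nextArrival D f z := by
  rw [bdStep]
  split_ifs
  · simp
  · rw [sup_eq_right.2 (hD.le_nextArrival f z)]

/-- Updating the second profile by the dual dynamics adds to the pairing the contribution of the
updated sites, which is symmetric in the two profiles. -/
theorem IsDisplacement.bdPairing_bdStep_right (hD : IsDisplacement D) (c : Site d → ℕ)
    (f g : Site d → EReal) :
    bdPairing D f (bdStep (dualDisplacement D) c g) = bdPairing D f g ⊔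
      ⨆ x, if c x = 0 then ⊥ else nextArrival D f x + nextArrival (dualDisplacement D) g x := by
  rw [bdPairing, bdPairing, ← iSup_sup_eq]
  refine iSup_congr fun x => ?_
  rw [hD.dual.bdStep_eq_sup, EReal.add_sup]
  split_ifs <;> simp

theorem dualDisplacement_dualDisplacement (D : Site d → EReal) :
    dualDisplacement (dualDisplacement D) = D := by
  ext x; simp [dualDisplacement]

theorem IsDisplacement.bdPairing_bdStep (hD : IsDisplacement D) (c : Site d → ℕ)
    (f g : Site d → EReal) :
    bdPairing D (bdStep D c f) g = bdPairing D f (bdStep (dualDisplacement D) c g) := by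
  have h := hD.dual.bdPairing_bdStep_right c g f
  rw [dualDisplacement_dualDisplacement] at h
  rw [bdPairing_comm, h, hD.bdPairing_bdStep_right, bdPairing_comm D f g]
  simp_rw [add_comm]

theorem discreteBD_succ' (D : Site d → EReal) (ξ₀ : Site d → EReal) (c : ℕ → Site d → ℕ)
    (n : ℕ) :
    discreteBD D ξ₀ c (n + 1) = discreteBD D (bdStep D (c 0) ξ₀) (fun k => c (k + 1)) n := by
  induction n with
  | zero => rfl
  | succ n ih => rw [discreteBD, ih]; rfl

theorem discreteBD_congr {D : Site d → EReal} {ξ₀ : Site d → EReal} {c c' : ℕ → Site d → ℕ}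
    {n : ℕ} (h : ∀ k < n, c k = c' k) : discreteBD D ξ₀ c n = discreteBD D ξ₀ c' n := by
  induction n with
  | zero => rfl
  | succ n ih => rw [discreteBD, discreteBD, ih fun k hk => h k (hk.trans n.lt_succ_self),
      h n n.lt_succ_self]

theorem IsDisplacement.bdPairing_discreteBD (hD : IsDisplacement D) (n : ℕ)
    (c : ℕ → Site d → ℕ) (f g : Site d → EReal) :
    bdPairing D (discreteBD D f c n) g =
      bdPairing D f (discreteBD (dualDisplacement D) g (fun k => c (n - 1 - k)) n) := by
  induction n generalizing g with
  | zero => rfl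
  | succ n ih =>
    rw [discreteBD, hD.bdPairing_bdStep, ih, discreteBD_succ']
    congr 1
    have : n + 1 - 1 - 0 = n := by omega
    rw [this]
    refine discreteBD_congr fun k hk => ?_
    congr 1
    omega

open Classical in
/-- The flat profile at height `0` restricted to the sites in `B`. -/
noncomputable def boxProfile (B : Set (Site d)) : Site d → EReal := fun x => if x ∈ B then 0 else ⊥

/-- Duality in discrete time: the next-arrival height at the origin, from the flat profile on `B`,
is the maximum over `B` of the dual next-arrival heights driven by the reversed arrivals. -/
theorem IsDisplacement.discrete_duality (hD : IsDisplacement D) (B : Set (Site d)) (n : ℕ)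
    (c : ℕ → Site d → ℕ) :
    nextArrival D (discreteBD D (boxProfile B) c n) 0 =
      ⨆ z ∈ B, nextArrival (dualDisplacement D)
        (discreteBD (dualDisplacement D) (seedProfile d) (fun k => c (n - 1 - k)) n) z := by
  have h := hD.bdPairing_discreteBD n c (boxProfile B) (seedProfile d)
  rw [bdPairing_comm D (boxProfile B)] at h
  have h1 : bdPairing D (discreteBD D (boxProfile B) c n) (seedProfile d) =
      nextArrival D (discreteBD D (boxProfile B) c n) 0 := by
    refine le_antisymm (iSup_le fun x => ?_) (le_iSup_of_le 0 (by simp [seedProfile]))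
    by_cases hx : x = 0 <;> simp [seedProfile, hx]
  rw [← h1, h, bdPairing]
  refine iSup_congr fun z => ?_
  by_cases hz : z ∈ B <;> simp [boxProfile, hz]

end Deterministic

/-! ### Percolation: no infinite chain of arrivals -/

section Paths

variable {d : ℕ} {D : Site d → EReal}

/-- `p` is a path whose first `n` sites are open, and each of whose first `n` steps leads to a site
seen from the current one. -/
def IsOpenPath (D : Site d → EReal) (o : Site d → Prop) (p : ℕ → Site d) (n : ℕ) : Prop :=
  ∀ i < n, o (p i) ∧ D (p i - p (i + 1)) ≠ ⊥

theorem finite_endpoints (hD : IsDisplacement D) (o : Site d → Prop) (z : Site d) (n : ℕ) :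
    {y | ∃ p : ℕ → Site d, p 0 = z ∧ p n = y ∧ IsOpenPath D o p n}.Finite := by
  induction n with
  | zero =>
    refine (Set.finite_singleton z).subset ?_
    rintro y ⟨p, rfl, rfl, _⟩
    rfl
  | succ n ih =>
    refine (ih.biUnion fun x _ => hD.finite_neighbours x).subset ?_
    rintro y ⟨p, h0, rfl, hp⟩
    exact Set.mem_biUnion (⟨p, h0, rfl, fun i hi => hp i (by omega)⟩ :
      p n ∈ {y | ∃ p : ℕ → Site d, p 0 = z ∧ p n = y ∧ IsOpenPath D o p n})
      (hp n n.lt_succ_self).2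

/-- A shortest open path to a reachable site visits distinct sites. Hence without self-avoiding
open paths of length `n` only finitely many sites are reachable. -/
theorem finite_reachable (hD : IsDisplacement D) {o : Site d → Prop} {z : Site d} {n : ℕ}
    (hn : ¬ ∃ p : ℕ → Site d, p 0 = z ∧ IsOpenPath D o p n ∧ Set.InjOn p (Set.Iio n)) :
    {y | ∃ m, ∃ p : ℕ → Site d, p 0 = z ∧ p m = y ∧ IsOpenPath D o p m}.Finite := by
  classical
  refine ((Set.finite_Iio n).biUnion fun m _ => finite_endpoints hD o z m).subset ?_
  intro y hy
  have hy' : ∃ m, ∃ p : ℕ → Site d, p 0 = z ∧ p m = y ∧ IsOpenPath D o p m := hy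
  obtain ⟨p, h0, hpm, hp⟩ := Nat.find_spec hy'
  refine Set.mem_biUnion (x := Nat.find hy') ?_ ⟨p, h0, hpm, hp⟩
  by_contra hlt
  have hlt : n ≤ Nat.find hy' := not_lt.1 hlt
  refine hn ⟨p, h0, fun i hi => hp i (hi.trans_le hlt), ?_⟩
  -- If `p i = p j` with `i < j`, then the loop between them can be cut out.
  have key : ∀ i j, i < j → j < n → p i ≠ p j := by
    intro i j hij hj heq
    refine Nat.find_min hy' (m := Nat.find hy' - (j - i)) (by omega)
      ⟨fun k => if k ≤ i then p k else p (k + (j - i)), by simp [h0], ?_, fun k hk => ?_⟩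
    · dsimp only
      have h1 : ¬ Nat.find hy' - (j - i) ≤ i := by omega
      have h2 : Nat.find hy' - (j - i) + (j - i) = Nat.find hy' := by omega
      rw [if_neg h1, h2, hpm]
    · rcases lt_trichotomy k i with hki | rfl | hki
      · have h1 : k + 1 ≤ i := hki
        simpa only [if_pos hki.le, if_pos h1] using hp k (by omega)
      · have h1 : ¬ k + 1 ≤ k := by omega
        have h2 : k + 1 + (j - k) = j + 1 := by omega
        simpa only [le_refl, if_true, if_neg h1, h2, heq] using hp j (by omega)
      · have h1 : ¬ k ≤ i := by omega
        have h2 : ¬ k + 1 ≤ i := by omega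
        have h3 : k + 1 + (j - i) = k + (j - i) + 1 := by omega
        simpa only [if_neg h1, if_neg h2, h3] using hp (k + (j - i)) (by omega)
  intro i hi j hj hij
  rcases lt_trichotomy i j with h | h | h
  · exact absurd hij (key i j h hj)
  · exact h
  · exact absurd hij.symm (key j i h hi)

/-- If in each of the time windows `(k * ε, (k + 1) * ε]` the self-avoiding paths along sites with
an arrival have bounded length, then the dependence relation is well-founded: the times along an
infinite chain of arrivals converge, hence stay in one window from some point on, where only
finitely many arrivals are available. -/
theorem isHarris_of_no_long_path (hD : IsDisplacement D) {arr : Site d → Set ℝ≥0}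
    (hfin : ∀ z t, (arr z ∩ Set.Iic t).Finite) {ε : ℝ≥0} (hε : 0 < ε)
    (hpath : ∀ (k : ℕ) (z : Site d), ∃ n, ¬ ∃ p : ℕ → Site d, p 0 = z ∧
      IsOpenPath D (fun x => arrivalIncr arr ε k x ≠ 0) p n ∧ Set.InjOn p (Set.Iio n)) :
    IsHarris D arr := by
  refine ⟨hfin, wellFounded_iff_isEmpty_descending_chain.2 ⟨?_⟩⟩
  rintro ⟨f, hf⟩
  set s : ℕ → ℝ≥0 := fun n => (f (n + 1)).1 with hs
  have hanti : StrictAnti s := strictAnti_nat_of_succ_lt fun n => (hf (n + 1)).2.2.1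
  have hbdd : BddBelow (Set.range s) := OrderBot.bddBelow _
  have hlim : Tendsto s atTop (𝓝 (⨅ n, s n)) := tendsto_atTop_ciInf hanti.antitone hbdd
  set ℓ := ⨅ n, s n
  have hℓ : ∀ n, ℓ < s n := fun n => (ciInf_le hbdd (n + 1)).trans_lt (hanti n.lt_succ_self)
  set k := ⌊ℓ / ε⌋₊
  have hk1 : k * ε ≤ ℓ := (le_div_iff₀ hε).1 (Nat.floor_le zero_le)
  have hk2 : ℓ < (k + 1 : ℕ) * ε := by
    rw [← div_lt_iff₀ hε]; push_cast; exact Nat.lt_floor_add_one _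
  obtain ⟨n₀, hn₀⟩ := eventually_atTop.1 (hlim.eventually_lt_const hk2)
  obtain ⟨n, hn⟩ := hpath k (f n₀).2
  have hfr := finite_reachable hD hn
  have hopen : ∀ m, n₀ ≤ m → arrivalIncr arr ε k (f m).2 ≠ 0 := fun m hm h0 =>
    (arrivalIncr_eq_zero_iff hfin ε k _).1 h0 (s m) ⟨hk1.trans_lt (hℓ m), (hn₀ m hm).le⟩ (hf m).1
  have hfin' := hfr.biUnion fun y _ => hfin y ((k + 1 : ℕ) * ε)
  refine Set.infinite_of_injective_forall_mem (f := fun i => s (n₀ + i))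
    (fun i j hij => by simpa using hanti.injective hij) (fun i => ?_) hfin'
  refine Set.mem_biUnion (x := (f (n₀ + i)).2) ⟨i, fun j => (f (n₀ + j)).2, rfl, rfl, ?_⟩
    ⟨(hf _).1, (hn₀ _ (by omega)).le⟩
  exact fun j _ => ⟨hopen _ (by omega), (hf (n₀ + j)).2.2.2⟩

end Paths

/-! ### The law of the increments of the arrival processes on a grid -/

section Law

variable {d : ℕ} {D : Site d → EReal}

/-- The law of the numbers of arrivals in the successive time intervals of length `h`: independent
Poisson variables with mean `h`, indexed by the time interval and the site. -/
noncomputable def gridLaw (d : ℕ) (h : ℝ≥0) : Measure (ℕ → Site d → ℕ) :=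
  Measure.infinitePi fun _ => Measure.infinitePi fun _ => poissonMeasure h

instance (d : ℕ) (h : ℝ≥0) : IsProbabilityMeasure (gridLaw d h) := by
  unfold gridLaw; infer_instance

/-- Exchanging the two indices of a doubly indexed family of independent, identically distributed
variables preserves its law. -/
theorem infinitePi_map_flip {ι κ X : Type*} [MeasurableSpace X] (ν : Measure X)
    [IsProbabilityMeasure ν] :
    (Measure.infinitePi fun _ : ι => Measure.infinitePi fun _ : κ => ν).map
      (fun f j i => f i j) = Measure.infinitePi fun _ : κ => Measure.infinitePi fun _ : ι => ν := by
  have h1 := Measure.infinitePi_map_curry_symm (fun (_ : ι) (_ : κ) => ν)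
  have h2 := Measure.map_infinitePi_infinitePi_of_inj (P := fun _ : ι × κ => ν)
    (f := Prod.swap (α := κ) (β := ι)) Prod.swap_injective
  have h3 := Measure.infinitePi_map_curry (fun (_ : κ) (_ : ι) => ν)
  rw [← h3, ← h2, ← h1, Measure.map_map (g := fun (ω : ι × κ → X) (i : κ × ι) => ω i.swap)
    (by fun_prop) (MeasurableEquiv.measurable _),
    Measure.map_map (MeasurableEquiv.measurable _) (by fun_prop)]
  rfl

/-- The law of the grid increments is invariant under a permutation of the time intervals. -/
theorem gridLaw_map_perm (d : ℕ) (h : ℝ≥0) {σ : ℕ → ℕ} (hσ : Function.Injective σ) :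
    (gridLaw d h).map (fun c k => c (σ k)) = gridLaw d h :=
  Measure.map_infinitePi_infinitePi_of_inj
    (P := fun _ : ℕ => Measure.infinitePi fun _ : Site d => poissonMeasure h) hσ

variable {Ω : Type*} [MeasurableSpace Ω] {μ : Measure Ω} {A : Site d → Ω → Set ℝ≥0}

theorem IsPoissonArrivals.hasLaw_arrivalIncr_apply (hA : IsPoissonArrivals μ A) (h : ℝ≥0) (k : ℕ)
    (z : Site d) :
    HasLaw (fun ω => arrivalIncr (fun z => A z ω) h k z) (poissonMeasure h) μ := by
  have hle : (k : ℝ≥0) * h ≤ (k + 1 : ℕ) * h := by gcongr; simp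
  have hsub : ((k + 1 : ℕ) : ℝ≥0) * h - k * h = h := by
    push_cast; rw [add_mul, one_mul, add_tsub_cancel_left]
  have hlaw := hA.law z _ _ hle
  rw [hsub] at hlaw
  exact hlaw

theorem IsPoissonArrivals.aemeasurable_arrivalIncr (hA : IsPoissonArrivals μ A) (h : ℝ≥0) :
    AEMeasurable (fun ω => arrivalIncr (fun z => A z ω) h) μ :=
  aemeasurable_pi_iff.2 fun k => aemeasurable_pi_iff.2 fun z =>
    (hA.hasLaw_arrivalIncr_apply h k z).aemeasurable

theorem IsPoissonArrivals.hasLaw_arrivalIncr_site [IsProbabilityMeasure μ]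
    (hA : IsPoissonArrivals μ A) (h : ℝ≥0) (z : Site d) :
    HasLaw (fun ω (k : ℕ) => arrivalIncr (fun z => A z ω) h k z)
      (Measure.infinitePi fun _ => poissonMeasure h) μ := by
  have hmono : Monotone fun k : ℕ => (k : ℝ≥0) * h := fun i j hij => by
    dsimp only; gcongr
  have hind := (hA.indep_increments z).nat hmono
  change iIndepFun (fun (k : ℕ) ω => arrivalIncr (fun z => A z ω) h k z) μ at hind
  exact iIndepFun.hasLaw_infinitePi (fun k => hA.hasLaw_arrivalIncr_apply h k z) hind
    (aemeasurable_pi_iff.2 fun k => (hA.hasLaw_arrivalIncr_apply h k z).aemeasurable)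

theorem IsPoissonArrivals.hasLaw_arrivalIncr [IsProbabilityMeasure μ]
    (hA : IsPoissonArrivals μ A) (h : ℝ≥0) :
    HasLaw (fun ω => arrivalIncr (fun z => A z ω) h) (gridLaw d h) μ := by
  have hind : iIndepFun (fun z ω (k : ℕ) => arrivalIncr (fun z => A z ω) h k z) μ :=
    hA.indep_sites.comp
      (fun _ (f : ℝ≥0 → ℕ) (k : ℕ) => f ((k + 1 : ℕ) * h) - f (k * h)) fun z => by fun_prop
  have hall := iIndepFun.hasLaw_infinitePi (fun z => hA.hasLaw_arrivalIncr_site h z) hind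
    (aemeasurable_pi_iff.2 fun z => (hA.hasLaw_arrivalIncr_site h z).aemeasurable)
  refine ⟨hA.aemeasurable_arrivalIncr h, ?_⟩
  have hflip : Measurable fun (f : Site d → ℕ → ℕ) (j : ℕ) (i : Site d) => f i j := by fun_prop
  have h1 := AEMeasurable.map_map_of_aemeasurable (g := fun (f : Site d → ℕ → ℕ) j i => f i j)
    hflip.aemeasurable hall.aemeasurable
  rw [hall.map_eq, infinitePi_map_flip] at h1
  exact h1.symm

theorem poissonMeasure_real_zero (h : ℝ≥0) : (poissonMeasure h).real {0} = Real.exp (-h) := by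
  simp [poissonMeasure_real_singleton]

theorem poissonMeasure_compl_zero_le (h : ℝ≥0) : poissonMeasure h {0}ᶜ ≤ h := by
  have h1 := Real.add_one_le_exp (-(h : ℝ))
  have h2 : (poissonMeasure h).real {0}ᶜ ≤ h := by
    rw [probReal_compl_eq_one_sub (measurableSet_singleton 0), poissonMeasure_real_zero]
    linarith
  rw [← ofReal_measureReal]
  exact (ENNReal.ofReal_le_ofReal h2).trans_eq ENNReal.ofReal_coe_nnreal

theorem IsPoissonArrivals.iIndepFun_arrivalIncr [IsProbabilityMeasure μ]
    (hA : IsPoissonArrivals μ A) (h : ℝ≥0) (k : ℕ) :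
    iIndepFun (fun z ω => arrivalIncr (fun z => A z ω) h k z) μ :=
  hA.indep_sites.comp
    (fun _ (f : ℝ≥0 → ℕ) => f ((k + 1 : ℕ) * h) - f (k * h)) fun z => by fun_prop

/-- Union bound over the at most `|𝒩| ^ n` paths, each open with probability at most `ε ^ n`. -/
theorem IsPoissonArrivals.measure_open_path_le [IsProbabilityMeasure μ]
    (hA : IsPoissonArrivals μ A) (hD : IsDisplacement D) (ε : ℝ≥0) (k : ℕ) (z : Site d) (n : ℕ) :
    μ {ω | ∃ p : ℕ → Site d, p 0 = z ∧
      IsOpenPath D (fun x => arrivalIncr (fun z => A z ω) ε k x ≠ 0) p n ∧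
        Set.InjOn p (Set.Iio n)} ≤ ((hD.finite.toFinset.card : ENNReal) * ε) ^ n := by
  classical
  -- The path with steps `v`.
  let P : (Fin n → Site d) → ℕ → Site d := fun v i =>
    z - ∑ j ∈ Finset.range i, if hj : j < n then v ⟨j, hj⟩ else 0
  let V : Finset (Fin n → Site d) := Fintype.piFinset fun _ => hD.finite.toFinset
  let E : (Fin n → Site d) → Set Ω := fun v => {ω | Set.InjOn (P v) (Set.Iio n) ∧
    ∀ i < n, arrivalIncr (fun z => A z ω) ε k (P v i) ≠ 0}
  have hsub : {ω | ∃ p : ℕ → Site d, p 0 = z ∧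
      IsOpenPath D (fun x => arrivalIncr (fun z => A z ω) ε k x ≠ 0) p n ∧
        Set.InjOn p (Set.Iio n)} ⊆ ⋃ v ∈ V, E v := by
    rintro ω ⟨p, h0, hp, hinj⟩
    have hP : ∀ i ≤ n, P (fun j => p j - p (j + 1)) i = p i := by
      intro i hi
      have : ∑ j ∈ Finset.range i, (if hj : j < n then p j - p (j + 1) else 0) =
          ∑ j ∈ Finset.range i, (p j - p (j + 1)) :=
        Finset.sum_congr rfl fun j hj => dif_pos ((Finset.mem_range.1 hj).trans_le hi)
      simp only [P]
      rw [this, Finset.sum_range_sub', h0]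
      abel
    refine Set.mem_biUnion (x := fun j : Fin n => p j - p (j + 1)) ?_ ⟨?_, fun i hi => ?_⟩
    · simp only [V, Finset.mem_coe, Fintype.mem_piFinset, Set.Finite.mem_toFinset]
      exact fun j => (hp j j.2).2
    · exact hinj.congr fun i (hi : i < n) => (hP i hi.le).symm
    · rw [hP i hi.le]
      exact (hp i hi).1
  have hE : ∀ v, μ (E v) ≤ (ε : ENNReal) ^ n := by
    intro v
    by_cases hinj : Set.InjOn (P v) (Set.Iio n)
    · let S := (Finset.range n).image (P v)
      have hS : S.card = n := by
        rw [Finset.card_image_of_injOn, Finset.card_range]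
        simpa using hinj
      have hEeq : E v ⊆ ⋂ x ∈ S, (fun ω => arrivalIncr (fun z => A z ω) ε k x) ⁻¹' {0}ᶜ := by
        rintro ω ⟨_, hω⟩
        simp only [Set.mem_iInter, S, Finset.mem_image, Finset.mem_range]
        rintro x ⟨i, hi, rfl⟩
        exact hω i hi
      refine (measure_mono hEeq).trans ?_
      rw [(hA.iIndepFun_arrivalIncr ε k).measure_inter_preimage_eq_mul S
        fun i _ => (measurableSet_singleton 0).compl]
      calc _ ≤ ∏ x ∈ S, (ε : ENNReal) := Finset.prod_le_prod' fun x _ => by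
            have := hA.hasLaw_arrivalIncr_apply ε k x
            rw [← Measure.map_apply_of_aemeasurable this.aemeasurable
              (measurableSet_singleton 0).compl, this.map_eq]
            exact poissonMeasure_compl_zero_le ε
        _ = _ := by rw [Finset.prod_const, hS]
    · have : E v = ∅ := Set.eq_empty_of_forall_notMem fun ω hω => hinj hω.1
      simp [this]
  calc _ ≤ μ (⋃ v ∈ V, E v) := measure_mono hsub
    _ ≤ ∑ v ∈ V, μ (E v) := measure_biUnion_finset_le _ _
    _ ≤ ∑ v ∈ V, (ε : ENNReal) ^ n := Finset.sum_le_sum fun v _ => hE v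
    _ = _ := by
      rw [Finset.sum_const, nsmul_eq_mul, mul_pow, Fintype.card_piFinset]
      simp

/-- Almost surely the arrivals determine the process. The window length is chosen so small that
the expected number of long self-avoiding open paths tends to zero. -/
theorem IsPoissonArrivals.ae_isHarris [IsProbabilityMeasure μ] (hA : IsPoissonArrivals μ A)
    (hD : IsDisplacement D) : ∀ᵐ ω ∂μ, IsHarris D fun z => A z ω := by
  set N := hD.finite.toFinset.card
  let ε : ℝ≥0 := (N + 1 : ℝ≥0)⁻¹
  have hε : 0 < ε := by positivity
  have hlt : (N : ENNReal) * ε < 1 := by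
    have : (N : ℝ≥0) * ε < 1 := by
      simp only [ε]
      rw [← div_eq_mul_inv, div_lt_one (by positivity)]
      exact lt_add_one _
    exact_mod_cast this
  have hpath : ∀ᵐ ω ∂μ, ∀ (k : ℕ) (z : Site d), ∃ n, ¬ ∃ p : ℕ → Site d, p 0 = z ∧
      IsOpenPath D (fun x => arrivalIncr (fun z => A z ω) ε k x ≠ 0) p n ∧
        Set.InjOn p (Set.Iio n) := by
    rw [ae_all_iff]
    intro k
    rw [ae_all_iff]
    intro z
    refine le_antisymm (ge_of_tendsto' (ENNReal.tendsto_pow_atTop_nhds_zero_of_lt_one hlt)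
      fun n => (measure_mono fun ω hω => ?_).trans (hA.measure_open_path_le hD ε k z n)) zero_le
    by_contra hn
    exact hω ⟨n, hn⟩
  filter_upwards [hpath, hA.locallyFinite] with ω h1 h2
  exact isHarris_of_no_long_path hD h2 hε h1

end Law

/-! ### Limits of random variables with equal or close laws -/

section Limit

variable {Ω Ω' : Type*} [MeasurableSpace Ω] [MeasurableSpace Ω'] {μ : Measure Ω} {μ' : Measure Ω'}
  [IsProbabilityMeasure μ] [IsProbabilityMeasure μ']

theorem identDistrib_of_ae_tendsto {X : ℕ → Ω → EReal} {Y : ℕ → Ω' → EReal} {x : Ω → EReal}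
    {y : Ω' → EReal} (h : ∀ n, IdentDistrib (X n) (Y n) μ μ')
    (hx : ∀ᵐ ω ∂μ, Tendsto (fun n => X n ω) atTop (𝓝 (x ω)))
    (hy : ∀ᵐ ω ∂μ', Tendsto (fun n => Y n ω) atTop (𝓝 (y ω))) : IdentDistrib x y μ μ' := by
  have hxm := aemeasurable_of_tendsto_metrizable_ae atTop (fun n => (h n).aemeasurable_fst) hx
  have hym := aemeasurable_of_tendsto_metrizable_ae atTop (fun n => (h n).aemeasurable_snd) hy
  refine ⟨hxm, hym, ?_⟩
  have h1 := tendstoInDistribution_of_ae_tendsto (l := atTop) (fun n => (h n).aemeasurable_fst)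
    hxm hx
  have h2 := tendstoInDistribution_of_ae_tendsto (l := atTop) (fun n => (h n).aemeasurable_snd)
    hym hy
  refine tendstoInDistribution_unique (l := atTop) X h1 ⟨h1.forall_aemeasurable, hym, ?_⟩
  convert! h2.tendsto using 2
  congr 1
  funext n
  exact Subtype.ext (h n).map_eq

end Limit

section TestFunctions

variable {Ω Ω' : Type*} [MeasurableSpace Ω] [MeasurableSpace Ω'] {μ : Measure Ω} {μ' : Measure Ω'}
  [IsProbabilityMeasure μ] [IsProbabilityMeasure μ']

theorem integrable_of_abs_le {f : Ω → ℝ} (hf : AEStronglyMeasurable f μ) {C : ℝ}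
    (h : ∀ ω, |f ω| ≤ C) : Integrable f μ :=
  Integrable.of_bound hf C (ae_of_all _ h)

/-- If the approximations are almost surely eventually equal to their limits, then bounded
measurable test functions, which need not be continuous, detect equality of the limit laws. -/
theorem identDistrib_of_tendsto_integral_sub {X : ℕ → Ω → EReal} {Y : ℕ → Ω' → EReal}
    {x : Ω → EReal} {y : Ω' → EReal} (hX : ∀ n, AEMeasurable (X n) μ)
    (hY : ∀ n, AEMeasurable (Y n) μ')
    (hx : ∀ᵐ ω ∂μ, ∀ᶠ n in atTop, X n ω = x ω) (hy : ∀ᵐ ω ∂μ', ∀ᶠ n in atTop, Y n ω = y ω)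
    (h : ∀ φ : EReal → ℝ, Measurable φ → (∀ a, |φ a| ≤ 1) →
      Tendsto (fun n => ∫ ω, φ (X n ω) ∂μ - ∫ ω, φ (Y n ω) ∂μ') atTop (𝓝 0)) :
    IdentDistrib x y μ μ' := by
  have hxm : AEMeasurable x μ := aemeasurable_of_tendsto_metrizable_ae atTop hX
    (hx.mono fun ω h => tendsto_const_nhds.congr' (h.mono fun n hn => hn.symm))
  have hym : AEMeasurable y μ' := aemeasurable_of_tendsto_metrizable_ae atTop hY
    (hy.mono fun ω h => tendsto_const_nhds.congr' (h.mono fun n hn => hn.symm))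
  refine ⟨hxm, hym, ?_⟩
  have key : ∀ φ : EReal → ℝ, Measurable φ → (∀ a, |φ a| ≤ 1) →
      ∫ ω, φ (x ω) ∂μ = ∫ ω, φ (y ω) ∂μ' := by
    intro φ hφ hφ1
    have h1 : Tendsto (fun n => ∫ ω, φ (X n ω) ∂μ) atTop (𝓝 (∫ ω, φ (x ω) ∂μ)) :=
      tendsto_integral_of_dominated_convergence (fun _ => 1)
        (fun n => (hφ.comp_aemeasurable (hX n)).aestronglyMeasurable) (integrable_const _)
        (fun n => ae_of_all _ fun ω => hφ1 _)
        (hx.mono fun ω h => tendsto_const_nhds.congr' (h.mono fun n hn => by simp only [hn]))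
    have h2 : Tendsto (fun n => ∫ ω, φ (Y n ω) ∂μ') atTop (𝓝 (∫ ω, φ (y ω) ∂μ')) :=
      tendsto_integral_of_dominated_convergence (fun _ => 1)
        (fun n => (hφ.comp_aemeasurable (hY n)).aestronglyMeasurable) (integrable_const _)
        (fun n => ae_of_all _ fun ω => hφ1 _)
        (hy.mono fun ω h => tendsto_const_nhds.congr' (h.mono fun n hn => by simp only [hn]))
    exact sub_eq_zero.1 (tendsto_nhds_unique (h1.sub h2) (h φ hφ hφ1))
  have := Measure.isProbabilityMeasure_map hxm
  have := Measure.isProbabilityMeasure_map hym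
  ext S hS
  have hφ : Measurable (S.indicator (1 : EReal → ℝ)) := measurable_one.indicator hS
  have h1 := key _ hφ fun a => by by_cases ha : a ∈ S <;> simp [ha]
  rw [← integral_map hxm hφ.aestronglyMeasurable, ← integral_map hym hφ.aestronglyMeasurable,
    integral_indicator_one hS, integral_indicator_one hS] at h1
  exact (measureReal_eq_measureReal_iff).1 h1

end TestFunctions

/-! ### Laws in discrete time -/

section Discrete

variable {d : ℕ} {D : Site d → EReal}

@[fun_prop]
theorem measurable_nextArrival (D : Site d → EReal) :
    Measurable fun f : Site d → EReal => nextArrival D f :=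
  measurable_pi_iff.2 fun x => Measurable.iSup fun y => by fun_prop

@[fun_prop]
theorem measurable_discreteBD (D : Site d → EReal) (ξ₀ : Site d → EReal) (k : ℕ) :
    Measurable fun c : ℕ → Site d → ℕ => discreteBD D ξ₀ c k := by
  induction k with
  | zero => exact measurable_const
  | succ k ih =>
    refine measurable_pi_iff.2 fun z => Measurable.ite ?_ (by fun_prop) ?_
    · exact (measurable_pi_apply z).comp (measurable_pi_apply k) (measurableSet_singleton 0)
    · exact (measurable_pi_apply z).comp ((measurable_nextArrival D).comp ih)

/-- The state of the process in discrete time is independent of the arrivals to come. -/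
theorem indepFun_discreteBD (D : Site d → EReal) (ξ₀ : Site d → EReal) (h : ℝ≥0) (k : ℕ) :
    IndepFun (fun c => c k) (fun c => discreteBD D ξ₀ c k) (gridLaw d h) := by
  have hind : iIndepFun (fun (k : ℕ) (c : ℕ → Site d → ℕ) => c k) (gridLaw d h) :=
    iIndepFun_infinitePi (X := fun _ f => f) fun _ => measurable_id
  have h1 := hind.indepFun_finset {k} (Finset.range k) (by simp) (by fun_prop)
  -- A configuration in the first `k` time intervals, extended by no arrivals.
  let ext : (Finset.range k → Site d → ℕ) → ℕ → Site d → ℕ := fun g i =>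
    if hi : i ∈ Finset.range k then g ⟨i, hi⟩ else 0
  have hext : Measurable ext := by
    refine measurable_pi_iff.2 fun i => ?_
    by_cases hi : i ∈ Finset.range k
    · simp only [ext, dif_pos hi]; fun_prop
    · simp only [ext, dif_neg hi]; fun_prop
  have h2 := IndepFun.comp h1 (measurable_pi_apply
    (⟨k, Finset.mem_singleton_self k⟩ : ({k} : Finset ℕ)))
    ((measurable_discreteBD D ξ₀ k).comp hext)
  convert! h2 using 1
  funext c
  exact discreteBD_congr fun i hi => by simp [ext, hi]

theorem integral_gridLaw_zero (h : ℝ≥0) (k : ℕ) (z : Site d) :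
    ∫ c, (if c k z = 0 then (1 : ℝ) else 0) ∂(gridLaw d h) = Real.exp (-h) := by
  have hlaw : HasLaw (fun c : ℕ → Site d → ℕ => c k z) (poissonMeasure h) (gridLaw d h) := by
    refine ⟨((measurable_pi_apply z).comp (measurable_pi_apply k)).aemeasurable, ?_⟩
    have := Measure.map_map (μ := gridLaw d h) (g := fun f : Site d → ℕ => f z)
      (f := fun c : ℕ → Site d → ℕ => c k) (by fun_prop) (by fun_prop)
    rw [gridLaw, Measure.infinitePi_map_eval, Measure.infinitePi_map_eval] at this
    exact this.symm
  have := hlaw.integral_comp (f := fun n : ℕ => if n = 0 then (1 : ℝ) else 0)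
    (measurable_of_countable _).aestronglyMeasurable
  refine this.trans ?_
  rw [← poissonMeasure_real_zero, ← integral_indicator_one (measurableSet_singleton 0)]
  refine integral_congr_ae (ae_of_all _ fun n => ?_)
  by_cases hn : n = 0 <;> simp [hn]

/-- Decomposition of the law of the height at `z` according to whether the site is updated in
the last step. -/
theorem integral_discreteBD_succ (D : Site d → EReal) (ξ₀ : Site d → EReal) (h : ℝ≥0) (k : ℕ)
    (z : Site d) {φ : EReal → ℝ} (hφ : Measurable φ) (hφ1 : ∀ a, |φ a| ≤ 1) :
    ∫ c, φ (discreteBD D ξ₀ c (k + 1) z) ∂(gridLaw d h) =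
      (1 - Real.exp (-h)) * ∫ c, φ (nextArrival D (discreteBD D ξ₀ c k) z) ∂(gridLaw d h) +
        Real.exp (-h) * ∫ c, φ (discreteBD D ξ₀ c k z) ∂(gridLaw d h) := by
  let e : (ℕ → Site d → ℕ) → ℝ := fun c => if c k z = 0 then 1 else 0
  have he : Measurable fun f : Site d → ℕ => if f z = 0 then (1 : ℝ) else 0 :=
    Measurable.ite (measurable_pi_apply z (measurableSet_singleton 0))
      measurable_const measurable_const
  have hem : Measurable e := he.comp (measurable_pi_apply k)
  have hm1 : Measurable fun c => φ (discreteBD D ξ₀ c k z) := by fun_prop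
  have hm2 : Measurable fun c => φ (nextArrival D (discreteBD D ξ₀ c k) z) := by fun_prop
  have hind := indepFun_discreteBD D ξ₀ h k
  have hi1 : ∫ c, e c * φ (discreteBD D ξ₀ c k z) ∂(gridLaw d h) =
      (∫ c, e c ∂(gridLaw d h)) * ∫ c, φ (discreteBD D ξ₀ c k z) ∂(gridLaw d h) :=
    (hind.comp he (ψ := fun f : Site d → EReal => φ (f z)) (by fun_prop)).integral_fun_mul_eq_mul_integral
      hem.aestronglyMeasurable hm1.aestronglyMeasurable
  have hi2 : ∫ c, (1 - e c) * φ (nextArrival D (discreteBD D ξ₀ c k) z) ∂(gridLaw d h) =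
      (∫ c, (1 - e c) ∂(gridLaw d h)) *
        ∫ c, φ (nextArrival D (discreteBD D ξ₀ c k) z) ∂(gridLaw d h) :=
    (hind.comp (he.const_sub 1) (ψ := fun f : Site d → EReal => φ (nextArrival D f z))
      (by fun_prop)).integral_fun_mul_eq_mul_integral
      (hem.const_sub 1).aestronglyMeasurable hm2.aestronglyMeasurable
  have he01 : ∀ c, |e c| ≤ 1 := fun c => by simp only [e]; split_ifs <;> simp
  have he01' : ∀ c, |1 - e c| ≤ 1 := fun c => by simp only [e]; split_ifs <;> simp
  have hint1 : Integrable (fun c => e c * φ (discreteBD D ξ₀ c k z)) (gridLaw d h) :=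
    integrable_of_abs_le (hem.mul hm1).aestronglyMeasurable (C := 1 * 1) fun c => by
      rw [abs_mul]; exact mul_le_mul (he01 c) (hφ1 _) (abs_nonneg _) zero_le_one
  have hint2 : Integrable (fun c => (1 - e c) * φ (nextArrival D (discreteBD D ξ₀ c k) z))
      (gridLaw d h) :=
    integrable_of_abs_le ((hem.const_sub 1).mul hm2).aestronglyMeasurable (C := 1 * 1) fun c => by
      rw [abs_mul]; exact mul_le_mul (he01' c) (hφ1 _) (abs_nonneg _) zero_le_one
  have hsplit : ∀ c, φ (discreteBD D ξ₀ c (k + 1) z) =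
      (1 - e c) * φ (nextArrival D (discreteBD D ξ₀ c k) z) +
        e c * φ (discreteBD D ξ₀ c k z) := by
    intro c
    simp only [discreteBD, bdStep, e]
    split_ifs <;> simp
  have he1 : ∫ c, e c ∂(gridLaw d h) = Real.exp (-h) := integral_gridLaw_zero h k z
  have he2 : ∫ c, (1 - e c) ∂(gridLaw d h) = 1 - Real.exp (-h) := by
    rw [integral_sub (integrable_const _) (integrable_of_abs_le hem.aestronglyMeasurable he01), he1]
    simp
  simp_rw [hsplit]
  rw [integral_add hint2 hint1, hi1, hi2, he1, he2]

/-- The law of the height at `z` after `n` steps, decomposed according to the number `j` of steps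
since the last update of `z`. -/
theorem integral_discreteBD (D : Site d → EReal) (ξ₀ : Site d → EReal) (h : ℝ≥0) (n : ℕ)
    (z : Site d) {φ : EReal → ℝ} (hφ : Measurable φ) (hφ1 : ∀ a, |φ a| ≤ 1) :
    ∫ c, φ (discreteBD D ξ₀ c n z) ∂(gridLaw d h) =
      ∑ j ∈ Finset.range n, Real.exp (-h) ^ j * (1 - Real.exp (-h)) *
        ∫ c, φ (nextArrival D (discreteBD D ξ₀ c (n - 1 - j)) z) ∂(gridLaw d h) +
      Real.exp (-h) ^ n * φ (ξ₀ z) := by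
  induction n with
  | zero => simp [discreteBD]
  | succ n ih =>
    have hidx : ∀ j, n + 1 - 1 - (j + 1) = n - 1 - j := fun j => by omega
    rw [integral_discreteBD_succ D ξ₀ h n z hφ hφ1, ih, Finset.sum_range_succ']
    simp_rw [hidx, pow_succ _ _, mul_right_comm _ (Real.exp _)]
    rw [← Finset.sum_mul]
    simp only [Nat.add_sub_cancel, Nat.sub_zero, pow_zero]
    ring

/-- Duality in law in discrete time: reversing the time intervals preserves the law of the
arrivals. -/
theorem identDistrib_discrete (hD : IsDisplacement D) (B : Set (Site d)) (h : ℝ≥0) (n : ℕ) :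
    IdentDistrib (fun c => nextArrival D (discreteBD D (boxProfile B) c n) 0)
      (fun c => ⨆ z ∈ B, nextArrival (dualDisplacement D)
        (discreteBD (dualDisplacement D) (seedProfile d) c n) z) (gridLaw d h) (gridLaw d h) := by
  let σ : ℕ → ℕ := fun k => if k < n then n - 1 - k else k
  have hσ : Function.Injective σ := by
    intro i j hij
    simp only [σ] at hij
    split_ifs at hij <;> omega
  have hm : Measurable fun c : ℕ → Site d → ℕ => ⨆ z ∈ B, nextArrival (dualDisplacement D)
      (discreteBD (dualDisplacement D) (seedProfile d) c n) z :=
    Measurable.biSup _ B.to_countable fun z _ => by fun_prop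
  have hm' : Measurable fun c : ℕ → Site d → ℕ => nextArrival D (discreteBD D (boxProfile B) c n) 0 :=
    by fun_prop
  refine ⟨hm'.aemeasurable, hm.aemeasurable, ?_⟩
  conv_rhs => rw [← gridLaw_map_perm d h hσ, Measure.map_map hm (by fun_prop)]
  congr 1
  funext c
  rw [hD.discrete_duality, Function.comp]
  refine iSup_congr fun z => iSup_congr fun _ => ?_
  congr 1
  refine discreteBD_congr fun k hk => ?_
  simp [σ, hk]

end Discrete

/-! ### Duality in law for the profile restricted to a finite box -/

section BoxDuality

variable {d : ℕ} {D : Site d → EReal}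

theorem IsHarris.eventually_nextArrival_discreteBD {arr : Site d → Set ℝ≥0}
    (hH : IsHarris D arr) (hD : IsDisplacement D) {ξ₀ : Site d → EReal}
    {ξ : ℝ≥0 → Site d → EReal} (hξ : IsBallisticDeposition D arr ξ₀ ξ)
    {h : ℕ → ℝ≥0} (hh : Tendsto h atTop (𝓝 0)) (t : ℝ≥0) (x : Site d) :
    ∀ᶠ n in atTop, ∀ k : ℕ, k * h n ≤ t →
      nextArrival D (discreteBD D ξ₀ (arrivalIncr arr (h n)) k) x =
        nextArrival D (ξ (k * h n)) x := by
  have hall : ∀ᶠ n in atTop, ∀ y ∈ {y | D (x - y) ≠ ⊥}, ∀ k : ℕ, k * h n < t + 1 →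
      discreteBD D ξ₀ (arrivalIncr arr (h n)) k y = ξ (k * h n) y := by
    rw [eventually_all_finite (hD.finite_neighbours x)]
    exact fun y _ => hH.eventually_discreteBD_eq hD hξ hh (t + 1) y
  filter_upwards [hall] with n hn k hk
  exact nextArrival_congr fun y hy => hn y hy k (hk.trans_lt (lt_add_one t))

theorem tendsto_mesh (t : ℝ≥0) : Tendsto (fun n : ℕ => t / ((n + 1 : ℕ) : ℝ≥0)) atTop (𝓝 0) :=
  NNReal.tendsto_coe.1 <| by
    simpa [Function.comp_def] using
      (tendsto_const_div_atTop_nhds_zero_nat (t : ℝ)).comp (tendsto_add_atTop_nat 1)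

theorem mul_mesh (t : ℝ≥0) (n : ℕ) : ((n + 1 : ℕ) : ℝ≥0) * (t / ((n + 1 : ℕ) : ℝ≥0)) = t :=
  mul_div_cancel₀ t (Nat.cast_ne_zero.2 n.succ_ne_zero)

theorem measurable_biSup_site {α : Type*} [MeasurableSpace α] (B : Set (Site d))
    {f : α → Site d → EReal} (hf : Measurable f) : Measurable fun a => ⨆ z ∈ B, f a z :=
  Measurable.biSup _ B.to_countable fun z _ => (measurable_pi_apply z).comp hf

theorem biSup_congr_mem {B : Set (Site d)} {f g : Site d → EReal} (h : ∀ z ∈ B, f z = g z) :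
    ⨆ z ∈ B, f z = ⨆ z ∈ B, g z :=
  iSup_congr fun z => iSup_congr fun hz => h z hz

/-- A unit exponential time falls into the `j`-th interval of length `h` with the probability that
the first interval with an arrival at a given site is the `j`-th. -/
theorem measureReal_exp_Ico {Ω' : Type*} [MeasurableSpace Ω'] {μ' : Measure Ω'}
    {T : Ω' → ℝ≥0} (hT : HasLaw (fun ω => (T ω : ℝ)) (expMeasure 1) μ')
    (h : ℝ≥0) (j : ℕ) :
    μ'.real {ω | j * h ≤ T ω ∧ T ω < (j + 1 : ℕ) * h} =
      Real.exp (-h) ^ j * (1 - Real.exp (-h)) := by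
  have : IsProbabilityMeasure (expMeasure 1) := isProbabilityMeasure_expMeasure one_pos
  have hna : NullSingletonClass (expMeasure 1) := nullSingletonClass_withDensity _
  have hle : (j : ℝ) * h ≤ (j + 1 : ℕ) * h := by gcongr; simp
  have h0 : (0 : ℝ) ≤ j * h := by positivity
  have hset : {ω | j * h ≤ T ω ∧ T ω < (j + 1 : ℕ) * h} =
      (fun ω => (T ω : ℝ)) ⁻¹' Set.Ico (j * h) ((j + 1 : ℕ) * h) := by
    ext ω
    simp only [Set.mem_preimage, Set.mem_Ico]
    exact_mod_cast Iff.rfl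
  rw [hset, ← map_measureReal_apply_of_aemeasurable hT.aemeasurable measurableSet_Ico, hT.map_eq,
    measureReal_congr Ico_ae_eq_Ioc, ← Set.Iic_sdiff_Iic,
    measureReal_sdiff (Set.Iic_subset_Iic.2 hle) measurableSet_Iic, ← cdf_eq_real, ← cdf_eq_real,
    cdf_expMeasure_eq one_pos, cdf_expMeasure_eq one_pos, if_pos h0, if_pos (h0.trans hle),
    ← Real.exp_nat_mul]
  have : -(1 * (((j + 1 : ℕ) : ℝ) * h)) = j * -h + -h := by push_cast; ring
  rw [this, Real.exp_add]
  have : -(1 * ((j : ℝ) * h)) = j * -h := by ring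
  rw [this]
  ring

theorem measureReal_exp_Ici {Ω' : Type*} [MeasurableSpace Ω'] {μ' : Measure Ω'}
    {T : Ω' → ℝ≥0} (hT : HasLaw (fun ω => (T ω : ℝ)) (expMeasure 1) μ')
    (h : ℝ≥0) (j : ℕ) : μ'.real {ω | j * h ≤ T ω} = Real.exp (-h) ^ j := by
  have : IsProbabilityMeasure (expMeasure 1) := isProbabilityMeasure_expMeasure one_pos
  have hna : NullSingletonClass (expMeasure 1) := nullSingletonClass_withDensity _
  have h0 : (0 : ℝ) ≤ j * h := by positivity
  have hset : {ω | j * h ≤ T ω} = (fun ω => (T ω : ℝ)) ⁻¹' Set.Ici (j * h) := by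
    ext ω
    simp only [Set.mem_preimage, Set.mem_Ici]
    exact_mod_cast Iff.rfl
  rw [hset, ← map_measureReal_apply_of_aemeasurable hT.aemeasurable measurableSet_Ici, hT.map_eq,
    measureReal_congr Ioi_ae_eq_Ici.symm, ← Set.compl_Iic,
    probReal_compl_eq_one_sub measurableSet_Iic, ← cdf_eq_real, cdf_expMeasure_eq one_pos,
    if_pos h0, ← Real.exp_nat_mul]
  have : -(1 * ((j : ℝ) * h)) = j * -h := by ring
  rw [this]
  ring

variable {Ω Ω' : Type*} [MeasurableSpace Ω] [MeasurableSpace Ω'] {μ : Measure Ω} {μ' : Measure Ω'}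
  [IsProbabilityMeasure μ] [IsProbabilityMeasure μ'] {A : Site d → Ω → Set ℝ≥0}
  {A' : Site d → Ω' → Set ℝ≥0} {ξ : Ω → ℝ≥0 → Site d → EReal} {ξ' : Ω' → ℝ≥0 → Site d → EReal}

/-- Duality in law for the next-arrival height, by approximation in discrete time. -/
theorem identDistrib_nextArrival_box (hD : IsDisplacement D) (hA : IsPoissonArrivals μ A)
    (hA' : IsPoissonArrivals μ' A') {B : Set (Site d)} (hB : B.Finite)
    (hξ : ∀ᵐ ω ∂μ, IsBallisticDeposition D (fun z => A z ω) (boxProfile B) (ξ ω))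
    (hξ' : ∀ᵐ ω ∂μ', IsBallisticDeposition (dualDisplacement D) (fun z => A' z ω)
      (seedProfile d) (ξ' ω)) (t : ℝ≥0) :
    IdentDistrib (fun ω => nextArrival D (ξ ω t) 0)
      (fun ω => ⨆ z ∈ B, nextArrival (dualDisplacement D) (ξ' ω t) z) μ μ' := by
  have hh := tendsto_mesh t
  have hdisc := fun n : ℕ => identDistrib_discrete hD B (t / ((n + 1 : ℕ) : ℝ≥0)) (n + 1)
  have hlaw := fun n : ℕ => hA.hasLaw_arrivalIncr (t / ((n + 1 : ℕ) : ℝ≥0))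
  have hlaw' := fun n : ℕ => hA'.hasLaw_arrivalIncr (t / ((n + 1 : ℕ) : ℝ≥0))
  refine identDistrib_of_ae_tendsto
    (X := fun n ω => nextArrival D (discreteBD D (boxProfile B)
      (arrivalIncr (fun z => A z ω) (t / ((n + 1 : ℕ) : ℝ≥0))) (n + 1)) 0)
    (Y := fun n ω => ⨆ z ∈ B, nextArrival (dualDisplacement D)
      (discreteBD (dualDisplacement D) (seedProfile d)
        (arrivalIncr (fun z => A' z ω) (t / ((n + 1 : ℕ) : ℝ≥0))) (n + 1)) z)
    (fun n => ?_) ?_ ?_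
  · have h1 := (hdisc n).aemeasurable_fst
    have h2 := (hdisc n).aemeasurable_snd
    have h3 := (hdisc n).map_eq
    rw [← (hlaw n).map_eq] at h1
    rw [← (hlaw' n).map_eq] at h2
    nth_rewrite 1 [← (hlaw n).map_eq] at h3
    rw [← (hlaw' n).map_eq, AEMeasurable.map_map_of_aemeasurable h1 (hlaw n).aemeasurable,
      AEMeasurable.map_map_of_aemeasurable h2 (hlaw' n).aemeasurable] at h3
    exact ⟨h1.comp_aemeasurable (hlaw n).aemeasurable,
      h2.comp_aemeasurable (hlaw' n).aemeasurable, h3⟩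
  · filter_upwards [hA.ae_isHarris hD, hξ] with ω hH hω
    refine tendsto_const_nhds.congr' ?_
    filter_upwards [hH.eventually_nextArrival_discreteBD hD hω hh t 0] with n hn
    rw [hn (n + 1) (mul_mesh t n).le, mul_mesh]
  · filter_upwards [hA'.ae_isHarris hD.dual, hξ'] with ω hH hω
    refine tendsto_const_nhds.congr' ?_
    have hall : ∀ᶠ n in atTop, ∀ z ∈ B, ∀ k : ℕ, k * (t / ((n + 1 : ℕ) : ℝ≥0)) ≤ t →
        nextArrival (dualDisplacement D) (discreteBD (dualDisplacement D) (seedProfile d)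
          (arrivalIncr (fun z => A' z ω) (t / ((n + 1 : ℕ) : ℝ≥0))) k) z =
        nextArrival (dualDisplacement D) (ξ' ω (k * (t / ((n + 1 : ℕ) : ℝ≥0)))) z := by
      rw [eventually_all_finite hB]
      exact fun z _ => hH.eventually_nextArrival_discreteBD hD.dual hω hh t z
    filter_upwards [hall] with n hn
    refine biSup_congr_mem fun z hz => ?_
    rw [hn z hz (n + 1) (mul_mesh t n).le, mul_mesh]


/-- The delayed process on the grid: `τ` is the delay and `w k` the value at time `k * h` after the
kick-off; the delay is rounded down to a multiple of `h`. -/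
noncomputable def gridDelay (h : ℝ≥0) (N : ℕ) (p : ℝ≥0 × (ℕ → EReal)) : EReal :=
  if p.1 < (N + 1 : ℕ) * h then p.2 (N - ⌊p.1 / h⌋₊) else 0

theorem measurable_gridDelay (h : ℝ≥0) (N : ℕ) : Measurable (gridDelay h N) := by
  have heval : Measurable fun p : ℕ × (ℕ → EReal) => p.2 p.1 :=
    measurable_from_prod_countable_right fun k => measurable_pi_apply k
  have hfl : Measurable fun p : ℝ≥0 × (ℕ → EReal) => N - ⌊p.1 / h⌋₊ :=
    (measurable_of_countable fun k : ℕ => N - k).comp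
      (Nat.measurable_floor.comp (measurable_fst.div_const h))
  exact Measurable.ite (measurable_fst measurableSet_Iio)
    (heval.comp (hfl.prodMk measurable_snd)) measurable_const

theorem apply_gridDelay {h : ℝ≥0} (hh : 0 < h) (N : ℕ) (τ : ℝ≥0) (w : ℕ → EReal) (φ : EReal → ℝ) :
    φ (gridDelay h N (τ, w)) =
      ∑ j ∈ Finset.range (N + 1),
        (Set.Ico (j * h) ((j + 1 : ℕ) * h)).indicator 1 τ * φ (w (N - j)) +
      (Set.Ici ((N + 1 : ℕ) * h)).indicator 1 τ * φ 0 := by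
  have hfl : ∀ j : ℕ, τ ∈ Set.Ico (j * h) ((j + 1 : ℕ) * h) ↔ ⌊τ / h⌋₊ = j := by
    intro j
    rw [Nat.floor_eq_iff zero_le, le_div_iff₀ hh, div_lt_iff₀ hh, Set.mem_Ico]
    push_cast
    rfl
  simp only [gridDelay, Set.indicator_apply, hfl, Set.mem_Ici, Pi.one_apply, ite_mul, one_mul,
    zero_mul, Finset.sum_ite_eq, Finset.mem_range]
  have hiff : ⌊τ / h⌋₊ < N + 1 ↔ τ < (N + 1 : ℕ) * h := by
    rw [Nat.floor_lt zero_le, div_lt_iff₀ hh]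
  by_cases hlt : τ < (N + 1 : ℕ) * h
  · rw [if_pos hlt, if_pos (hiff.2 hlt), if_neg (not_le.2 hlt), add_zero]
  · rw [if_neg hlt, if_neg (mt hiff.1 hlt), if_pos (not_lt.1 hlt), zero_add]

theorem integral_gridDelay {T : Ω' → ℝ≥0} (hT : HasLaw (fun ω => (T ω : ℝ)) (expMeasure 1) μ')
    {W : ℕ → Ω' → EReal} (hW : ∀ k, AEMeasurable (W k) μ') (hind : ∀ k, IndepFun T (W k) μ')
    {h : ℝ≥0} (hh : 0 < h) (N : ℕ) {φ : EReal → ℝ} (hφ : Measurable φ) (hφ1 : ∀ a, |φ a| ≤ 1) :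
    ∫ ω, φ (gridDelay h N (T ω, fun k => W k ω)) ∂μ' =
      ∑ j ∈ Finset.range (N + 1), Real.exp (-h) ^ j * (1 - Real.exp (-h)) *
        ∫ ω, φ (W (N - j) ω) ∂μ' + Real.exp (-h) ^ (N + 1) * φ 0 := by
  have hTm : AEMeasurable T μ' := by simpa using hT.aemeasurable
  have hind1 : ∀ S : Set ℝ≥0, MeasurableSet S →
      Measurable (S.indicator (1 : ℝ≥0 → ℝ)) := fun S hS => measurable_one.indicator hS
  have hindm : ∀ S : Set ℝ≥0, MeasurableSet S →
      AEStronglyMeasurable (fun ω => S.indicator (1 : ℝ≥0 → ℝ) (T ω)) μ' := fun S hS =>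
    ((hind1 S hS).comp_aemeasurable hTm).aestronglyMeasurable
  have hindle : ∀ (S : Set ℝ≥0) a, |S.indicator (1 : ℝ≥0 → ℝ) a| ≤ 1 := fun S a => by
    by_cases ha : a ∈ S <;> simp [ha]
  have hφm : ∀ k, AEStronglyMeasurable (fun ω => φ (W k ω)) μ' := fun k =>
    (hφ.comp_aemeasurable (hW k)).aestronglyMeasurable
  have hintS : ∀ S : Set ℝ≥0, MeasurableSet S →
      ∫ ω, S.indicator (1 : ℝ≥0 → ℝ) (T ω) ∂μ' = μ'.real (T ⁻¹' S) := fun S hS => by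
    rw [← map_measureReal_apply_of_aemeasurable hTm hS, ← integral_indicator_one hS,
      integral_map hTm (hind1 S hS).aestronglyMeasurable]
  have hint1 : ∀ j : ℕ, Integrable (fun ω =>
      (Set.Ico (j * h) ((j + 1 : ℕ) * h)).indicator (1 : ℝ≥0 → ℝ) (T ω) * φ (W (N - j) ω)) μ' :=
    fun j => integrable_of_abs_le ((hindm _ measurableSet_Ico).mul (hφm _)) (C := 1 * 1) fun ω => by
      rw [abs_mul]; exact mul_le_mul (hindle _ _) (hφ1 _) (abs_nonneg _) zero_le_one
  have hint2 : Integrable (fun ω =>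
      (Set.Ici ((N + 1 : ℕ) * h)).indicator (1 : ℝ≥0 → ℝ) (T ω) * φ 0) μ' :=
    (integrable_of_abs_le (hindm _ measurableSet_Ici) fun ω => hindle _ _).mul_const _
  simp_rw [apply_gridDelay hh]
  rw [integral_add (integrable_finsetSum _ fun j _ => hint1 j) hint2,
    integral_finsetSum _ fun j _ => hint1 j,
    integral_mul_const, hintS _ measurableSet_Ici]
  congr 1
  · refine Finset.sum_congr rfl fun j _ => ?_
    have := ((hind (N - j)).comp (hind1 (Set.Ico (j * h) ((j + 1 : ℕ) * h)) measurableSet_Ico)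
      hφ).integral_fun_mul_eq_mul_integral (hindm _ measurableSet_Ico) (hφm _)
    refine this.trans ?_
    congr 1
    exact (hintS _ measurableSet_Ico).trans (measureReal_exp_Ico hT h j)
  · congr 1
    exact measureReal_exp_Ici hT h (N + 1)

/-- Duality in law for the last-arrival height. In discrete time the number of steps since the last
update of the origin is geometric, with the same parameter as the delay rounded down to the grid,
and independent of the next-arrival height before that update. The horizon is taken one step beyond
`t`: then the grid times paired with the delay `T` approximate `t - T` from the right, where the dual
process is continuous. -/
theorem identDistrib_height_box (hD : IsDisplacement D) (hA : IsPoissonArrivals μ A)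
    (hA' : IsPoissonArrivals μ' A') {B : Set (Site d)} (hB : B.Finite) (h0B : 0 ∈ B)
    (hξ : ∀ᵐ ω ∂μ, IsBallisticDeposition D (fun z => A z ω) (boxProfile B) (ξ ω))
    (hξ' : ∀ᵐ ω ∂μ', IsBallisticDeposition (dualDisplacement D) (fun z => A' z ω)
      (seedProfile d) (ξ' ω)) {t : ℝ≥0} (ht : 0 < t) {T : Ω' → ℝ≥0}
    (hT : HasLaw (fun ω => (T ω : ℝ)) (expMeasure 1) μ')
    (hind : IndepFun T (fun ω s x => nextArrival (dualDisplacement D) (ξ' ω s) x) μ') :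
    IdentDistrib (fun ω => ξ ω t 0)
      (fun ω => ⨆ z ∈ B, delayedNextArrival (dualDisplacement D) (ξ' ω) (T ω) t z) μ μ' := by
  set h : ℕ → ℝ≥0 := fun n => t / ((n + 1 : ℕ) : ℝ≥0) with hdef
  have hh : Tendsto h atTop (𝓝 0) := tendsto_mesh t
  have hh0 : ∀ n, 0 < h n := fun n => by positivity
  have hNh : ∀ n, ((n + 1 : ℕ) : ℝ≥0) * h n = t := mul_mesh t
  have hN1h : ∀ n, ((n + 1 + 1 : ℕ) : ℝ≥0) * h n = t + h n := fun n => by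
    rw [Nat.cast_succ (n + 1), add_mul, hNh, one_mul]
  have hTm : AEMeasurable T μ' := by simpa using hT.aemeasurable
  -- The dual next-arrival heights at grid times, for the true and for the discretized process.
  let W : ℕ → ℕ → Ω' → EReal := fun n k ω =>
    ⨆ z ∈ B, nextArrival (dualDisplacement D) (ξ' ω (k * h n)) z
  let V : ℕ → ℕ → (ℕ → Site d → ℕ) → EReal := fun n k c =>
    ⨆ z ∈ B, nextArrival (dualDisplacement D)
      (discreteBD (dualDisplacement D) (seedProfile d) c k) z
  have hW : ∀ n k, AEMeasurable (W n k) μ' := fun n k =>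
    (identDistrib_nextArrival_box hD hA hA' hB hξ hξ' (k * h n)).aemeasurable_snd
  have hV : ∀ n k, Measurable (V n k) := fun n k => measurable_biSup_site B (by fun_prop)
  have hWind : ∀ n k, IndepFun T (W n k) μ' := fun n k =>
    hind.comp (ψ := fun η : ℝ≥0 → Site d → EReal => ⨆ z ∈ B, η (k * h n) z) measurable_id
      (measurable_biSup_site B (measurable_pi_apply _))
  have hlaw := fun n => hA.hasLaw_arrivalIncr (h n)
  have hlaw' := fun n => hA'.hasLaw_arrivalIncr (h n)
  refine identDistrib_of_tendsto_integral_sub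
    (X := fun n ω => discreteBD D (boxProfile B) (arrivalIncr (fun z => A z ω) (h n)) (n + 1 + 1) 0)
    (Y := fun n ω => gridDelay (h n) (n + 1) (T ω, fun k => W n k ω))
    (fun n => ?_) (fun n => ?_) ?_ ?_ ?_
  · exact ((measurable_pi_apply 0).comp
      (measurable_discreteBD D (boxProfile B) (n + 1 + 1))).comp_aemeasurable (hlaw n).aemeasurable
  · exact (measurable_gridDelay _ _).comp_aemeasurable
      (hTm.prodMk (aemeasurable_pi_iff.2 fun k => hW n k))
  · filter_upwards [hA.ae_isHarris hD, hξ] with ω hH hω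
    obtain ⟨r, hr, hr'⟩ := exists_gt_no_arrival hH.locallyFinite (Set.finite_singleton 0) t
    filter_upwards [hH.eventually_discreteBD_eq hD hω hh (t + 1) 0,
      hh.eventually_lt_const one_pos, hh.eventually_lt_const (tsub_pos_of_lt hr)] with n hn hn1 hnr
    have hle : t + h n ≤ r := by
      rw [← add_tsub_cancel_of_le hr.le]; gcongr
    rw [hn (n + 1 + 1) (by rw [hN1h]; gcongr), hN1h]
    exact hω.const 0 t _ le_self_add fun u hu => hr' 0 rfl u ⟨hu.1, hu.2.trans hle⟩
  · filter_upwards [hA'.ae_isHarris hD.dual, hξ'] with ω hH hω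
    rcases le_or_gt (T ω) t with hTt | hTt
    · -- The kick-off has happened: the elapsed time is approximated from the right.
      set r := t - T ω with hr
      have hrT : r + T ω = t := tsub_add_cancel_of_le hTt
      obtain ⟨r', hrr', hr'⟩ := exists_gt_no_arrival hH.locallyFinite
        (hB.biUnion fun z _ => hD.dual.finite_neighbours z) r
      filter_upwards [hh.eventually_lt_const (tsub_pos_of_lt hrr')] with n hn
      have hle : r + h n ≤ r' := by
        rw [← add_tsub_cancel_of_le hrr'.le]; gcongr
      have hlt : T ω < (n + 1 + 1 : ℕ) * h n := by
        rw [hN1h]; exact hTt.trans_lt (lt_add_of_pos_right _ (hh0 n))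
      set J := ⌊T ω / h n⌋₊
      have hJ1 : J * h n ≤ T ω := (le_div_iff₀ (hh0 n)).1 (Nat.floor_le zero_le)
      have hJ2 : T ω < J * h n + h n := by
        have := (div_lt_iff₀ (hh0 n)).1 (Nat.lt_floor_add_one (T ω / h n))
        rwa [add_mul, one_mul] at this
      have hJN : J ≤ n + 1 := by
        have : J < n + 1 + 1 := by
          rw [Nat.floor_lt zero_le, div_lt_iff₀ (hh0 n)]; exact hlt
        omega
      set s := ((n + 1 - J : ℕ) : ℝ≥0) * h n with hs
      have hsJ : s + J * h n = t := by
        rw [hs, ← add_mul, ← Nat.cast_add, Nat.sub_add_cancel hJN, hNh]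
      have hrs : r ≤ s := by
        rw [hr, tsub_le_iff_right, ← hsJ]; gcongr
      have hsr : s ≤ r + h n := by
        have : s + J * h n ≤ (r + h n) + J * h n := by
          rw [hsJ, ← hrT, add_assoc, add_comm (h n)]; gcongr
        exact le_of_add_le_add_right this
      simp only [gridDelay, if_pos hlt, W]
      refine biSup_congr_mem fun z hz => ?_
      rw [delayedNextArrival, if_pos hTt]
      refine nextArrival_congr fun y hy => hω.const y r s hrs fun u hu => ?_
      exact hr' y (Set.mem_biUnion hz hy) u ⟨hu.1, hu.2.trans (hsr.trans hle)⟩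
    · filter_upwards [hh.eventually_lt_const (tsub_pos_of_lt hTt)] with n hn
      have hle : t + h n ≤ T ω := by
        rw [← add_tsub_cancel_of_le hTt.le]; gcongr
      have hlt : ¬ T ω < (n + 1 + 1 : ℕ) * h n := by rw [hN1h]; exact not_lt.2 hle
      simp only [gridDelay, if_neg hlt, delayedNextArrival, if_neg (not_le.2 hTt)]
      exact (biSup_const ⟨0, h0B⟩).symm
  · intro φ hφ hφ1
    set q : ℕ → ℝ := fun n => Real.exp (-h n) with hq
    have hq0 : ∀ n, 0 ≤ q n := fun n => (Real.exp_pos _).le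
    have hq1 : ∀ n, q n ≤ 1 := fun n => Real.exp_le_one_iff.2 (by simp)
    -- The difference of the two mixtures over the delay, before taking expectations.
    let R : ℕ → Ω' → ℝ := fun n ω => ∑ j ∈ Finset.range (n + 1 + 1), q n ^ j * (1 - q n) *
      (φ (V n (n + 1 - j) (arrivalIncr (fun z => A' z ω) (h n))) - φ (W n (n + 1 - j) ω))
    have hVm : ∀ n k, AEStronglyMeasurable
        (fun ω => φ (V n k (arrivalIncr (fun z => A' z ω) (h n)))) μ' := fun n k =>
      ((hφ.comp (hV n k)).comp_aemeasurable (hlaw' n).aemeasurable).aestronglyMeasurable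
    have hWm : ∀ n k, AEStronglyMeasurable (fun ω => φ (W n k ω)) μ' := fun n k =>
      (hφ.comp_aemeasurable (hW n k)).aestronglyMeasurable
    have hVi := fun n k => integrable_of_abs_le (hVm n k) fun _ => hφ1 _
    have hWi := fun n k => integrable_of_abs_le (hWm n k) fun _ => hφ1 _
    have hR : ∀ n, ∫ ω, φ (discreteBD D (boxProfile B) (arrivalIncr (fun z => A z ω) (h n))
        (n + 1 + 1) 0) ∂μ - ∫ ω, φ (gridDelay (h n) (n + 1) (T ω, fun k => W n k ω)) ∂μ' =
        ∫ ω, R n ω ∂μ' := by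
      intro n
      have h1 := (hlaw n).integral_comp (f := fun c => φ (discreteBD D (boxProfile B) c
        (n + 1 + 1) 0)) (Measurable.aestronglyMeasurable (by fun_prop))
      have h2 : ∀ k, ∫ c, φ (nextArrival D (discreteBD D (boxProfile B) c k) 0)
          ∂(gridLaw d (h n)) = ∫ ω, φ (V n k (arrivalIncr (fun z => A' z ω) (h n))) ∂μ' := by
        intro k
        refine (((identDistrib_discrete hD B (h n) k).comp hφ).integral_eq).trans ?_
        exact ((hlaw' n).integral_comp (f := fun c => φ (V n k c))
          (hφ.comp (hV n k)).aestronglyMeasurable).symm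
      simp only [Function.comp_def] at h1
      rw [h1, integral_discreteBD D _ (h n) _ 0 hφ hφ1,
        integral_gridDelay hT (hW n) (hWind n) (hh0 n) (n + 1) hφ hφ1]
      simp only [R]
      have hi : ∀ j : ℕ, Integrable (fun ω => q n ^ j * (1 - q n) *
          (φ (V n (n + 1 - j) (arrivalIncr (fun z => A' z ω) (h n))) -
            φ (W n (n + 1 - j) ω))) μ' := fun j => ((hVi n _).sub (hWi n _)).const_mul _
      rw [integral_finsetSum _ fun j _ => hi j]
      simp_rw [integral_const_mul, integral_sub (hVi n _) (hWi n _), mul_sub,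
        Finset.sum_sub_distrib, h2]
      have hb : boxProfile B 0 = 0 := by simp [boxProfile, h0B]
      rw [hb]
      simp only [Nat.add_sub_cancel, hq]
      ring
    simp_rw [hR]
    rw [← integral_zero Ω' ℝ (μ := μ')]
    refine tendsto_integral_of_dominated_convergence (fun _ => 2) (fun n => ?_)
      (integrable_const _) (fun n => ae_of_all _ fun ω => ?_) ?_
    · exact Finset.aestronglyMeasurable_fun_sum _ fun j _ =>
        ((hVm n _).sub (hWm n _)).const_mul _
    · calc ‖R n ω‖ ≤ ∑ j ∈ Finset.range (n + 1 + 1), q n ^ j * (1 - q n) * 2 := by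
            refine norm_sum_le_of_le _ fun j _ => ?_
            have hc : 0 ≤ q n ^ j * (1 - q n) :=
              mul_nonneg (pow_nonneg (hq0 n) _) (sub_nonneg.2 (hq1 n))
            rw [norm_mul, Real.norm_of_nonneg hc]
            refine mul_le_mul_of_nonneg_left ?_ hc
            refine (norm_sub_le _ _).trans ?_
            have := add_le_add (hφ1 (V n (n + 1 - j) (arrivalIncr (fun z => A' z ω) (h n))))
              (hφ1 (W n (n + 1 - j) ω))
            rw [Real.norm_eq_abs, Real.norm_eq_abs]
            linarith
        _ = (1 - q n ^ (n + 1 + 1)) * 2 := by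
            rw [← Finset.sum_mul, ← Finset.sum_mul, geom_sum_mul_neg]
        _ ≤ 2 := by
            have := pow_nonneg (hq0 n) (n + 1 + 1)
            linarith
    · filter_upwards [hA'.ae_isHarris hD.dual, hξ'] with ω hH hω
      refine tendsto_const_nhds.congr' ?_
      have hall : ∀ᶠ n in atTop, ∀ z ∈ B, ∀ k : ℕ, k * h n ≤ t →
          nextArrival (dualDisplacement D) (discreteBD (dualDisplacement D) (seedProfile d)
            (arrivalIncr (fun z => A' z ω) (h n)) k) z =
          nextArrival (dualDisplacement D) (ξ' ω (k * h n)) z := by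
        rw [eventually_all_finite hB]
        exact fun z _ => hH.eventually_nextArrival_discreteBD hD.dual hω hh t z
      filter_upwards [hall] with n hn
      refine (Finset.sum_eq_zero fun j _ => ?_).symm
      have hjt : ((n + 1 - j : ℕ) : ℝ≥0) * h n ≤ t := by
        rw [← hNh n]; gcongr; omega
      have : V n (n + 1 - j) (arrivalIncr (fun z => A' z ω) (h n)) = W n (n + 1 - j) ω :=
        biSup_congr_mem fun z hz => hn z hz _ hjt
      rw [this, sub_self, mul_zero]

end BoxDuality

/-! ### Exhaustion of the lattice by boxes -/

/-- The box `[-m, m]^d`. -/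
def siteBox (d m : ℕ) : Set (Site d) := Set.Icc (fun _ => -(m : ℤ)) fun _ => (m : ℤ)

theorem finite_siteBox (d m : ℕ) : (siteBox d m).Finite := Set.finite_Icc _ _

theorem zero_mem_siteBox (d m : ℕ) : (0 : Site d) ∈ siteBox d m :=
  ⟨fun _ => by simp, fun _ => by simp⟩

theorem siteBox_mono (d : ℕ) : Monotone (siteBox d) := fun m n hmn =>
  Set.Icc_subset_Icc (fun _ => by simpa using hmn) fun _ => by simpa using hmn

theorem eventually_mem_siteBox {d : ℕ} (z : Site d) : ∀ᶠ m in atTop, z ∈ siteBox d m := by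
  refine eventually_atTop.2 ⟨∑ i, (z i).natAbs, fun m hm => ?_⟩
  have h : ∀ i, |z i| ≤ m := fun i => by
    have := (Finset.single_le_sum (f := fun i => (z i).natAbs) (fun _ _ => Nat.zero_le _)
      (Finset.mem_univ i)).trans hm
    rw [Int.abs_eq_natAbs]
    exact_mod_cast this
  exact ⟨fun i => (abs_le.1 (h i)).1, fun i => (abs_le.1 (h i)).2⟩

theorem tendsto_biSup_siteBox {d : ℕ} (f : Site d → EReal) :
    Tendsto (fun m => ⨆ z ∈ siteBox d m, f z) atTop (𝓝 (⨆ z, f z)) := by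
  have hmono : Monotone fun m => ⨆ z ∈ siteBox d m, f z := fun m n hmn =>
    biSup_mono fun z hz => siteBox_mono d hmn hz
  have hsup : ⨆ m, ⨆ z ∈ siteBox d m, f z = ⨆ z, f z := by
    refine le_antisymm (iSup_le fun m => iSup₂_le fun z _ => le_iSup f z) (iSup_le fun z => ?_)
    obtain ⟨m, hm⟩ := (eventually_mem_siteBox z).exists
    exact le_iSup_of_le m (le_iSup₂_of_le z hm le_rfl)
  exact hsup ▸ tendsto_atTop_iSup hmono

/-- Processes started from the flat profiles on growing boxes, and their convergence to the process
started from the flat profile. -/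
theorem IsPoissonArrivals.exists_box_process {d : ℕ} {D : Site d → EReal} {Ω : Type*}
    [MeasurableSpace Ω] {μ : Measure Ω} [IsProbabilityMeasure μ] {A : Site d → Ω → Set ℝ≥0}
    (hA : IsPoissonArrivals μ A) (hD : IsDisplacement D) {ξ : Ω → ℝ≥0 → Site d → EReal}
    (hξ : ∀ᵐ ω ∂μ, IsBallisticDeposition D (fun z => A z ω) (flatProfile d) (ξ ω)) :
    ∃ ζ : ℕ → Ω → ℝ≥0 → Site d → EReal,
      (∀ m, ∀ᵐ ω ∂μ, IsBallisticDeposition D (fun z => A z ω) (boxProfile (siteBox d m)) (ζ m ω)) ∧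
      ∀ᵐ ω ∂μ, ∀ t z, ∀ᶠ m in atTop, ζ m ω t z = ξ ω t z := by
  let ζ : ℕ → Ω → ℝ≥0 → Site d → EReal := fun m ω => Classical.epsilon
    fun ζ => IsBallisticDeposition D (fun z => A z ω) (boxProfile (siteBox d m)) ζ
  have hζ : ∀ m ω, IsHarris D (fun z => A z ω) →
      IsBallisticDeposition D (fun z => A z ω) (boxProfile (siteBox d m)) (ζ m ω) := fun m ω hH =>
    Classical.epsilon_spec (hH.exists_isBallisticDeposition hD _)
  refine ⟨ζ, fun m => (hA.ae_isHarris hD).mono fun ω => hζ m ω, ?_⟩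
  filter_upwards [hA.ae_isHarris hD, hξ] with ω hH hω t z
  refine (hH.eventually_eq hD hω (fun m => hζ m ω hH) (fun z => ?_) (t + 1) z).mono
    fun m hm => hm t (lt_add_one t)
  filter_upwards [eventually_mem_siteBox z] with m hm
  simp [boxProfile, flatProfile, hm]

theorem theorem2p3 {d : ℕ} (D : Site d → EReal) (hD : IsDisplacement D)
    {Ω : Type*} [MeasurableSpace Ω] (μ : Measure Ω) [IsProbabilityMeasure μ]
    (A : Site d → Ω → Set ℝ≥0) (hA : IsPoissonArrivals μ A)
    {Ω' : Type*} [MeasurableSpace Ω'] (μ' : Measure Ω') [IsProbabilityMeasure μ']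
    (A' : Site d → Ω' → Set ℝ≥0) (hA' : IsPoissonArrivals μ' A') :
    -- the BD process `ξ` and the dual BD process `ξ'` driven by these arrivals are well defined
    (∀ᵐ ω ∂μ, ∃! ξ, IsBallisticDeposition D (fun z => A z ω) (flatProfile d) ξ) ∧
    (∀ᵐ ω ∂μ', ∃! ξ', IsBallisticDeposition (dualDisplacement D) (fun z => A' z ω)
      (seedProfile d) ξ') ∧
    -- and they satisfy the duality relations
    ∀ ξ : Ω → ℝ≥0 → Site d → EReal,
      (∀ᵐ ω ∂μ, IsBallisticDeposition D (fun z => A z ω) (flatProfile d) (ξ ω)) →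
    ∀ ξ' : Ω' → ℝ≥0 → Site d → EReal,
      (∀ᵐ ω ∂μ', IsBallisticDeposition (dualDisplacement D) (fun z => A' z ω)
        (seedProfile d) (ξ' ω)) →
    ∀ t : ℝ≥0, 0 < t →
      IdentDistrib (fun ω => nextArrival D (ξ ω t) 0)
        (fun ω => ⨆ z, nextArrival (dualDisplacement D) (ξ' ω t) z) μ μ' ∧
      ∀ T : Ω' → ℝ≥0, HasLaw (fun ω => (T ω : ℝ)) (expMeasure 1) μ' →
        IndepFun T (fun ω s x => nextArrival (dualDisplacement D) (ξ' ω s) x) μ' →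
        IdentDistrib (fun ω => ξ ω t 0)
          (fun ω => ⨆ z, delayedNextArrival (dualDisplacement D) (ξ' ω) (T ω) t z) μ μ' := by
  refine ⟨(hA.ae_isHarris hD).mono fun ω hH => hH.existsUnique hD _,
    (hA'.ae_isHarris hD.dual).mono fun ω hH => hH.existsUnique hD.dual _, ?_⟩
  intro ξ hξ ξ' hξ' t ht
  obtain ⟨ζ, hζ, hlim⟩ := hA.exists_box_process hD hξ
  refine ⟨identDistrib_of_ae_tendsto
    (fun m => identDistrib_nextArrival_box hD hA hA' (finite_siteBox d m) (hζ m) hξ' t) ?_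
    (ae_of_all _ fun ω => tendsto_biSup_siteBox _), fun T hT hind => identDistrib_of_ae_tendsto
    (fun m => identDistrib_height_box hD hA hA' (finite_siteBox d m) (zero_mem_siteBox d m)
      (hζ m) hξ' ht hT hind) ?_ (ae_of_all _ fun ω => tendsto_biSup_siteBox _)⟩
  · filter_upwards [hlim] with ω hω
    refine tendsto_const_nhds.congr' ?_
    have hall : ∀ᶠ m in atTop, ∀ y ∈ {y | D (0 - y) ≠ ⊥}, ζ m ω t y = ξ ω t y := by
      rw [eventually_all_finite (hD.finite_neighbours 0)]
      exact fun y _ => hω t y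
    filter_upwards [hall] with m hm
    exact (nextArrival_congr hm).symm
  · filter_upwards [hlim] with ω hω
    exact tendsto_const_nhds.congr' ((hω t 0).mono fun m hm => hm.symm)
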